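/- **Setting.** Let $\mathcal V=\{1,\dots,N\}$ carry a directed graph with edge set $\mathcal E$, and let $\mathcal N_i=\{j\neq i:(j,i)\in\mathcal E\}$. Consider the coupled subsystems $\dot x_i=f_i(x_i,u_i,[x_j]_{j\in\mathcal N_i})$, $f_i(0,0,0)=0$, written centrally as $\dot x=F(x,u)$, with $u_i\in U_i$, $U_i$ compact and convex, $U=\prod_i U_i$. Let $l(x,u)=\sum_i l_i(x_i,u_i)$ and $V(x)=\sum_i V_i(x_i)$ with $l_i,V_i\ge 0$, $T>0$, and $$J(u,x_0)=V(x(T))+\int_0^T l(x,u)\,d\tau,\qquad \dot x=F(x,u),\ x(0)=x_0,\ u(\tau)\in U .$$ Assume that $f_i,l_i,V_i$ are continuously differentiable, that $m_l(\|x\|^2+\|u\|^2)\le l(x,u)\le M_l(\|x\|^2+\|u\|^2)$ and $m_V\|x\|^2\le V(x)\le M_V\|x\|^2$ with $m_l,M_l>0$, $m_V,M_V\ge0$, that every admissible control has a bounded response on $[0,T]$, and that for every $x_0$ an optimal solution $(x^*,u^*)(\cdot;x_0)$ exists. Put $J^*(x_0)=J(u^*(\cdot;x_0),x_0)$ and $\Gamma_a=\{x_0:J^*(x_0)\le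 a\}$. Let $0<\Delta t\le T$ be the sampling time and $\rho>0$. With local copies $v_{ji}$ of $x_j$ ($j\in\mathcal N_i$), coordination variables $z_i$ and multipliers $\mu_{ii},\mu_{ji}$, let $$J_\rho(w,z,\mu;x_0)=V(x(T))+\int_0^T l(x,u)+\sum_i\Big[\mu_{ii}^{\top}(z_i-x_i)+\tfrac\rho2\|z_i-x_i\|^2+\sum_{j\in\mathcal N_i}\big(\mu_{ji}^{\top}(z_j-v_{ji})+\tfrac\rho2\|z_j-v_{ji}\|^2\big)\Big]d\tau$$ with $w=(u,v)$, $v\in L^\infty$, subject to $\dot x_i=f_i(x_i,u_i,v_i)$, $x(0)=x_0$, $u\in U$. An ADMM iteration from $(z^{q-1},\mu^{q-1})$ minimizes $J_\rho(\cdot,z^{q-1},\mu^{q-1};x_0)$ to obtain $w^q$, minimizes $J_\rho(w^q,\cdot,\mu^{q-1};x_0)$ over $L^\infty$ to obtain $z^q$, and sets $\mu_{ii}^q=\mu_{ii}^{q-1}+\rho(z_i^q-x_i^q)$, $\mu_{ji}^q=\mu_{ji}^{q-1}+\rho(z_j^q-v_{ji}^q)$. Norms of trajectories are $L^\infty(0,T)$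 norms. **Assumptions.** 1. For some $\beta>0$ the set $\Omega_\beta=\{V\le\beta\}$ is non-empty and compact, and there is a feedback $\kappa_V$ with $\kappa_V(x)\in U$ and $\nabla V(x)^{\top}F(x,\kappa_V(x))+l(x,\kappa_V(x))\le0$ on $\Omega_\beta$. Put $\alpha=\beta(1+\frac{m_l}{M_V}T)$; the set $\Gamma_\alpha$ is compact. 2. $J^*$ is twice continuously differentiable at the points of $\Gamma_\alpha$. For $x_0\in\Gamma_\alpha$ there are feedback laws, locally Lipschitz in all arguments (and allowed to depend on $\tau$, with local Lipschitz constants uniform in $\tau$), such that $u^*(\tau;x_0)=\kappa^*(\tau,x^*(\tau;x_0);x_0)$ for a.e. $\tau\in[0,\Delta t)$, and such that every minimizer $w=(u,v)$ of $J_\rho(\cdot,z,\mu;x_0)$, with state $x$, satisfies $u(\tau)=\kappa(\tau,x(\tau);z,\mu,x_0)$ for a.e. $\tau\in[0,T]$, where $(z,\mu)$ ranges over the neighbourhoods $\mathcal Z^{\sigma_z},\mathcal M^{\sigma_\mu}$ of assumption 4. 3. For each $x_0\in\Gamma_\alpha$ there is a unique $\mu^*(\cdot;x_0)\in L^\infty$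 such that, with $z^*=x^*$, $v^*_{ji}=x^*_j$, $w^*=(u^*,v^*)$, one has $J_\rho(w^*,z^*,\mu)\le J_\rho(w^*,z^*,\mu^*)\le J_\rho(w,z,\mu^*)$ for all $\mu$ and all admissible $(w,z)$. The maps $x_0\mapsto z^*(\cdot;x_0),\mu^*(\cdot;x_0)\in L^\infty$ are locally Lipschitz on $\Gamma_\alpha$. 4. There are $\sigma_z,\sigma_\mu>0$ such that, for $\mathcal Z^{\sigma_z}$, $\mathcal M^{\sigma_\mu}$ the open $\sigma_z$-, $\sigma_\mu$-neighbourhoods in $L^\infty$ of $\{z^*(\cdot;x_0):x_0\in\Gamma_\alpha\}$, $\{\mu^*(\cdot;x_0):x_0\in\Gamma_\alpha\}$, the ADMM iteration for every $x_0\in\Gamma_\alpha$ is executable at every $(z,\mu)\in\mathcal Z^{\sigma_z}\times\mathcal M^{\sigma_\mu}$, and all iterates started there stay there. 5. (R-linear convergence.) There are $C_0>0$, $C\in[0,1)$ such that for every $x_0\in\Gamma_\alpha$, every ADMM sequence started in $\mathcal Z^{\sigma_z}\times\mathcal M^{\sigma_\mu}$ and every $q\ge1$ $$\left\|\begin{matrix}z^q-z^*(\cdot;x_0)\\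 \mu^q-\mu^*(\cdot;x_0)\end{matrix}\right\|_{L^\infty}\le C_0C^q\left\|\begin{matrix}z^0-z^*(\cdot;x_0)\\ \mu^0-\mu^*(\cdot;x_0)\end{matrix}\right\|_{L^\infty}.$$ **DMPC scheme with $\hat q$ iterations.** In MPC step $k$, with state $x_k$, exactly $\hat q$ ADMM iterations are performed (no stopping criterion is checked), $x_F(\cdot;x_k)$ is the solution of $\dot x=F(x,u^{\hat q})$ on $[0,T]$ from $x_k$, $x_{k+1}=x_F(\Delta t;x_k)$, and step $k+1$ is started at the final $(z^{\hat q},\mu^{\hat q})$ of step $k$. The closed-loop state is $x(k\Delta t+\tau)=x_F(\tau;x_k)$, $0\le\tau<\Delta t$. **Theorem.** Under assumptions 1–5 there are $\hat\alpha\in(0,\alpha]$, a fixed integer $\hat q>0$, and constants $c,\gamma_1,\gamma_2>0$, $\gamma\in(0,1)$ and $E$ such that for every $x_0\in\Gamma_{\hat\alpha}$ and every initialization $(z^0,\mu^0)\in\mathcal Z^{\sigma_z}\times\mathcal M^{\sigma_\mu}$ of step $k=0$, with initial ADMM error $e_0=\max(\|z^0-z^*(\cdot;x_0)\|,\|\mu^0-\mu^*(\cdot;x_0)\|)$,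 one has $e_0\le E$, the DMPC scheme with $\hat q$ iterations per step can be executed for all $k$, and every run of it satisfies $$x_k\in\Gamma_{\hat\alpha},\qquad J^*(x_k)\le c\,\gamma^k\,(J^*(x_0)+e_0^2),\qquad \sup_{\tau\in[0,T]}\|x_F(\tau;x_k)-x^*(\tau;x_k)\|\le c\,\gamma^k\,(\|x_0\|+e_0)$$ for all $k\ge 0$, and $$\|x(t)\|\le\gamma_1(\|x_0\|+e_0)\,e^{-\gamma_2t}\qquad(t\ge0).$$ -/

import Mathlib

open MeasureTheory Set Filter Topology
open scoped ENNReal NNReal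

noncomputable section

/-- Data of a distributed optimal control problem: a directed graph on the subsystems `Fin N`,
dimensions, dynamics `f i` (arguments: own state, own control, stacked states of the sending
neighbours), stage costs `l i`, terminal costs `V i`, control constraint sets `U i`, the horizon
`T`, and the constants of the quadratic cost bounds. -/
structure DMPC (N : ℕ) where
  n : Fin N → ℕ
  m : Fin N → ℕ
  edges : Finset (Fin N × Fin N)
  f : ∀ i : Fin N, EuclideanSpace ℝ (Fin (n i)) → EuclideanSpace ℝ (Fin (m i)) →
    PiLp 2 (fun j : {j : Fin N // (j, i) ∈ edges ∧ j ≠ i} => EuclideanSpace ℝ (Fin (n j.1))) →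
    EuclideanSpace ℝ (Fin (n i))
  l : ∀ i : Fin N, EuclideanSpace ℝ (Fin (n i)) → EuclideanSpace ℝ (Fin (m i)) → ℝ
  V : ∀ i : Fin N, EuclideanSpace ℝ (Fin (n i)) → ℝ
  U : ∀ i : Fin N, Set (EuclideanSpace ℝ (Fin (m i)))
  T : ℝ
  ml : ℝ
  Ml : ℝ
  mV : ℝ
  MV : ℝ

namespace DMPC

variable {N : ℕ} (P : DMPC N)

/-- The sending neighbours of subsystem `i`. -/
abbrev Sender (i : Fin N) : Type := {j : Fin N // (j, i) ∈ P.edges ∧ j ≠ i}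

abbrev St (i : Fin N) : Type := EuclideanSpace ℝ (Fin (P.n i))

abbrev Ct (i : Fin N) : Type := EuclideanSpace ℝ (Fin (P.m i))

/-- Values of the local copies `v_i = [v_{ji}]_j`, `j` a sending neighbour of `i`. -/
abbrev Cp (i : Fin N) : Type := PiLp 2 (fun j : P.Sender i => P.St j.1)

/-- The stacked spaces, with Euclidean norms. -/
abbrev State : Type := PiLp 2 P.St

abbrev Ctrl : Type := PiLp 2 P.Ct

abbrev Copies : Type := PiLp 2 P.Cp

/-- Values of the multipliers `μ = [μ_i]_i`, `μ_i = (μ_{ii}, [μ_{ji}]_j)`. -/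
abbrev MultVal : Type := PiLp 2 (fun i => WithLp 2 (P.St i × P.Cp i))

/-- Lebesgue measure on the prediction horizon `[0, T]`. -/
abbrev horizon : Measure ℝ := volume.restrict (Icc 0 P.T)

/-- `L^∞(0, T)` trajectories of the coordination variables. -/
abbrev ZTraj : Type := Lp P.State ∞ P.horizon

/-- `L^∞(0, T)` trajectories of the multipliers. -/
abbrev MTraj : Type := Lp P.MultVal ∞ P.horizon

/-- The stacked true neighbour states `[[x_j]_j]_i` belonging to a state `x`. -/
def hat (x : P.State) : P.Copies :=
  WithLp.toLp 2 (fun i => WithLp.toLp 2 (fun j : P.Sender i => x j.1))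

/-- The decoupled dynamics `f = [f_i]_i`, with local copies `v` in place of neighbour states. -/
def fStack (x : P.State) (u : P.Ctrl) (v : P.Copies) : P.State :=
  WithLp.toLp 2 (fun i => P.f i (x i) (u i) (v i))

/-- The centralized dynamics. -/
def F (x : P.State) (u : P.Ctrl) : P.State := P.fStack x u (P.hat x)

def stageCost (x : P.State) (u : P.Ctrl) : ℝ := ∑ i, P.l i (x i) (u i)

def termCost (x : P.State) : ℝ := ∑ i, P.V i (x i)

/-- `x` is the (absolutely continuous) solution on `[0, T]` of `ẋ = r`, `x(0) = x₀`. -/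
def IsResponse (x₀ : P.State) (r x : ℝ → P.State) : Prop :=
  ContinuousOn x (Icc 0 P.T) ∧ ∀ t ∈ Icc 0 P.T, x t = x₀ + ∫ s in (0 : ℝ)..t, r s

/-- Measurable control trajectories with values in `U = ∏ i, U i` on `[0, T]`. -/
def IsControl (u : ℝ → P.Ctrl) : Prop :=
  AEStronglyMeasurable u P.horizon ∧ ∀ t ∈ Icc 0 P.T, ∀ i, u t i ∈ P.U i

/-- `x` is the response of the coupled system to the control `u`. -/
def IsPlantTraj (x₀ : P.State) (u : ℝ → P.Ctrl) (x : ℝ → P.State) : Prop :=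
  P.IsResponse x₀ (fun s => P.F (x s) (u s)) x

/-- The cost functional `V(x(T)) + ∫ l(x, u)`. -/
def cost (x : ℝ → P.State) (u : ℝ → P.Ctrl) : ℝ :=
  P.termCost (x P.T) + ∫ t, P.stageCost (x t) (u t) ∂P.horizon

/-- `(x, u)` is an optimal solution of the centralized optimal control problem from `x₀`. -/
def IsOptimal (x₀ : P.State) (x : ℝ → P.State) (u : ℝ → P.Ctrl) : Prop :=
  P.IsControl u ∧ P.IsPlantTraj x₀ u x ∧
    ∀ u' x', P.IsControl u' → P.IsPlantTraj x₀ u' x' → P.cost x u ≤ P.cost x' u'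

/-- Standing assumptions on the problem data. A response is continuous on `[0, T]`, hence bounded,
so `response` says that every admissible control yields a bounded state response. -/
structure Standing : Prop where
  T_pos : 0 < P.T
  f_smooth : ∀ i, ContDiff ℝ 1 (fun p : P.St i × P.Ct i × P.Cp i => P.f i p.1 p.2.1 p.2.2)
  f_zero : ∀ i, P.f i 0 0 0 = 0
  l_smooth : ∀ i, ContDiff ℝ 1 (fun p : P.St i × P.Ct i => P.l i p.1 p.2)
  l_nonneg : ∀ i x u, 0 ≤ P.l i x u
  V_smooth : ∀ i, ContDiff ℝ 1 (P.V i)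
  V_nonneg : ∀ i x, 0 ≤ P.V i x
  U_compact : ∀ i, IsCompact (P.U i)
  U_convex : ∀ i, Convex ℝ (P.U i)
  ml_pos : 0 < P.ml
  Ml_pos : 0 < P.Ml
  mV_nonneg : 0 ≤ P.mV
  MV_nonneg : 0 ≤ P.MV
  l_lower : ∀ x u, P.ml * (‖x‖ ^ 2 + ‖u‖ ^ 2) ≤ P.stageCost x u
  l_upper : ∀ x u, P.stageCost x u ≤ P.Ml * (‖x‖ ^ 2 + ‖u‖ ^ 2)
  V_lower : ∀ x, P.mV * ‖x‖ ^ 2 ≤ P.termCost x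
  V_upper : ∀ x, P.termCost x ≤ P.MV * ‖x‖ ^ 2
  response : ∀ x₀ u, P.IsControl u → ∃ x, P.IsPlantTraj x₀ u x

/-- The terminal cost is a control Lyapunov function on the compact sublevel set `Ω_β`. -/
def IsCLF (β : ℝ) : Prop :=
  0 < β ∧ {x | P.termCost x ≤ β}.Nonempty ∧ IsCompact {x | P.termCost x ≤ β} ∧
    ∃ κV : P.State → P.Ctrl, ∀ x, P.termCost x ≤ β →
      (∀ i, κV x i ∈ P.U i) ∧
        fderiv ℝ P.termCost x (P.F x (κV x)) + P.stageCost x (κV x) ≤ 0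

/-- The level `α = β (1 + (m_l / M_V) T)`. -/
def level (β : ℝ) : ℝ := β * (1 + P.ml / P.MV * P.T)

/-! ### Decomposition and ADMM -/

/-- State, control and local copy trajectories of all subsystems; `(u, v)` is `w`. -/
structure Primal where
  x : ℝ → P.State
  u : ℝ → P.Ctrl
  v : ℝ → P.Copies

/-- `(u, v) ∈ 𝒲` and `x` solves the decoupled dynamics with initial value `x₀`. -/
def IsFeasible (x₀ : P.State) (w : P.Primal) : Prop :=
  P.IsControl w.u ∧ MemLp w.v ∞ P.horizon ∧
    P.IsResponse x₀ (fun s => P.fStack (w.x s) (w.u s) (w.v s)) w.x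

/-- The augmented Lagrangian. -/
def augLag (ρ : ℝ) (w : P.Primal) (z : P.ZTraj) (μ : P.MTraj) : ℝ :=
  P.cost w.x w.u + ∫ t, ∑ i,
    ((inner ℝ (μ t i).fst (z t i - w.x t i) + ρ / 2 * ‖z t i - w.x t i‖ ^ 2) +
      ∑ j : P.Sender i, (inner ℝ ((μ t i).snd j) (z t j.1 - w.v t i j) +
        ρ / 2 * ‖z t j.1 - w.v t i j‖ ^ 2)) ∂P.horizon

/-- `w` minimizes the augmented Lagrangian for fixed `(z, μ)`. -/
def IsPrimalMin (ρ : ℝ) (x₀ : P.State) (z : P.ZTraj) (μ : P.MTraj) (w : P.Primal) : Prop :=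
  P.IsFeasible x₀ w ∧ ∀ w', P.IsFeasible x₀ w' → P.augLag ρ w z μ ≤ P.augLag ρ w' z μ

/-- The saddle point condition. -/
def IsSaddle (ρ : ℝ) (x₀ : P.State) (w : P.Primal) (z : P.ZTraj) (μ : P.MTraj) : Prop :=
  P.IsFeasible x₀ w ∧ (∀ μ', P.augLag ρ w z μ' ≤ P.augLag ρ w z μ) ∧
    ∀ w' z', P.IsFeasible x₀ w' → P.augLag ρ w z μ ≤ P.augLag ρ w' z' μ

/-- One ADMM iteration: from `(z, μ)` to `(w', z', μ')`. -/
structure IsADMMStep (ρ : ℝ) (x₀ : P.State) (z : P.ZTraj) (μ : P.MTraj)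
    (w' : P.Primal) (z' : P.ZTraj) (μ' : P.MTraj) : Prop where
  w_min : P.IsPrimalMin ρ x₀ z μ w'
  z_min : ∀ z'', P.augLag ρ w' z' μ ≤ P.augLag ρ w' z'' μ
  mu_own : ∀ᵐ t ∂P.horizon, ∀ i, (μ' t i).fst = (μ t i).fst + ρ • (z' t i - w'.x t i)
  mu_copy : ∀ᵐ t ∂P.horizon, ∀ i, ∀ j : P.Sender i,
    (μ' t i).snd j = (μ t i).snd j + ρ • (z' t j.1 - w'.v t i j)

/-- `Q` consecutive ADMM iterations for the state `x₀`, started at `(z 0, μ 0)`. The entry `w 0`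
plays no role. -/
def IsADMMRun (ρ : ℝ) (x₀ : P.State) (Q : ℕ)
    (w : ℕ → P.Primal) (z : ℕ → P.ZTraj) (μ : ℕ → P.MTraj) : Prop :=
  ∀ q < Q, P.IsADMMStep ρ x₀ (z q) (μ q) (w (q + 1)) (z (q + 1)) (μ (q + 1))

/-! ### Optimal quantities and the assumptions on them -/

/-- A choice, for every state `x₀`, of optimal state, control, coordination and multiplier
trajectories `x*(·; x₀)`, `u*(·; x₀)`, `z*(·; x₀)`, `μ*(·; x₀)`. -/
structure OptData where
  x : P.State → ℝ → P.State
  u : P.State → ℝ → P.Ctrl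
  z : P.State → P.ZTraj
  mu : P.State → P.MTraj

variable {P}

/-- The optimal cost `J*`. -/
def OptData.J (S : P.OptData) (x₀ : P.State) : ℝ := P.cost (S.x x₀) (S.u x₀)

/-- The sublevel set `Γ_a` of the optimal cost. -/
def OptData.Γ (S : P.OptData) (a : ℝ) : Set P.State := {x₀ | S.J x₀ ≤ a}

/-- The `σ`-neighbourhood of `{z*(·; x₀) | x₀ ∈ Γ_a}`. -/
def OptData.ZNhd (S : P.OptData) (a σ : ℝ) : Set P.ZTraj := Metric.thickening σ (S.z '' S.Γ a)

/-- The `σ`-neighbourhood of `{μ*(·; x₀) | x₀ ∈ Γ_a}`. -/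
def OptData.MNhd (S : P.OptData) (a σ : ℝ) : Set P.MTraj := Metric.thickening σ (S.mu '' S.Γ a)

/-- The `L^∞` norm of the stacked error `(z - z*, μ - μ*)` (as the maximum of both norms). -/
def OptData.err (S : P.OptData) (x₀ : P.State) (z : P.ZTraj) (μ : P.MTraj) : ℝ :=
  max ‖z - S.z x₀‖ ‖μ - S.mu x₀‖

/-- The optimal primal trajectories, at which the consistency constraints hold. -/
def OptData.w (S : P.OptData) (x₀ : P.State) : P.Primal :=
  ⟨S.x x₀, S.u x₀, fun t => P.hat (S.x x₀ t)⟩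

/-- Local Lipschitz continuity of `g τ` on `D`, locally uniformly with respect to `τ ∈ I`. -/
def LocLipOn {A B : Type*} [PseudoEMetricSpace A] [PseudoEMetricSpace B]
    (I : Set ℝ) (D : Set A) (g : ℝ → A → B) : Prop :=
  ∀ a ∈ D, ∃ K : ℝ≥0, ∃ W ∈ 𝓝[D] a, ∀ τ ∈ I, LipschitzOnWith K (g τ) W

/-- Regularity: `J*` is twice continuously differentiable on `Γ_a`, and both the centralized
optimal control and the control computed in an ADMM iteration from the previous iterate `(z, μ)`
are given by locally Lipschitz feedback laws. The laws may (but need not) depend on the time `τ`,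
as optimal feedback laws on a finite horizon do. -/
structure OptData.IsRegular (S : P.OptData) (ρ Δt a σz σμ : ℝ) : Prop where
  J_smooth : ∀ x₀ ∈ S.Γ a, ContDiffAt ℝ 2 S.J x₀
  feedback_opt : ∃ κ : ℝ → P.State × P.State → P.Ctrl,
    LocLipOn (Ico 0 Δt) (univ ×ˢ S.Γ a) κ ∧
    ∀ x₀ ∈ S.Γ a, ∀ᵐ τ ∂(volume.restrict (Ico 0 Δt)), S.u x₀ τ = κ τ (S.x x₀ τ, x₀)
  feedback_admm : ∃ κ : ℝ → P.State × P.ZTraj × P.MTraj × P.State → P.Ctrl,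
    LocLipOn (Icc 0 P.T) (univ ×ˢ S.ZNhd a σz ×ˢ S.MNhd a σμ ×ˢ S.Γ a) κ ∧
    ∀ x₀ ∈ S.Γ a, ∀ z ∈ S.ZNhd a σz, ∀ μ ∈ S.MNhd a σμ, ∀ w, P.IsPrimalMin ρ x₀ z μ w →
      ∀ᵐ τ ∂P.horizon, w.u τ = κ τ (w.x τ, z, μ, x₀)

/-- Unique bounded optimal multipliers satisfying the saddle point condition, and locally
Lipschitz dependence of `z*`, `μ*` on the state. -/
structure OptData.HasMultipliers (S : P.OptData) (ρ a : ℝ) : Prop where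
  z_eq : ∀ x₀ ∈ S.Γ a, ∀ᵐ t ∂P.horizon, S.z x₀ t = S.x x₀ t
  saddle : ∀ x₀ ∈ S.Γ a, P.IsSaddle ρ x₀ (S.w x₀) (S.z x₀) (S.mu x₀)
  unique : ∀ x₀ ∈ S.Γ a, ∀ μ, P.IsSaddle ρ x₀ (S.w x₀) (S.z x₀) μ → μ = S.mu x₀
  z_lip : LocallyLipschitzOn (S.Γ a) S.z
  mu_lip : LocallyLipschitzOn (S.Γ a) S.mu

/-- The ADMM algorithm, started in the neighbourhoods, generates iterates, and these stay in the
neighbourhoods. -/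
structure OptData.ADMMBounded (S : P.OptData) (ρ a σz σμ : ℝ) : Prop where
  generates : ∀ x₀ ∈ S.Γ a, ∀ z ∈ S.ZNhd a σz, ∀ μ ∈ S.MNhd a σμ,
    ∃ w' z' μ', P.IsADMMStep ρ x₀ z μ w' z' μ'
  bounded : ∀ x₀ ∈ S.Γ a, ∀ Q w z μ, P.IsADMMRun ρ x₀ Q w z μ →
    z 0 ∈ S.ZNhd a σz → μ 0 ∈ S.MNhd a σμ → z Q ∈ S.ZNhd a σz ∧ μ Q ∈ S.MNhd a σμ

/-- R-linear convergence of the ADMM iterates. -/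
def OptData.RLinear (S : P.OptData) (ρ a σz σμ : ℝ) : Prop :=
  ∃ C₀ C : ℝ, 0 < C₀ ∧ 0 ≤ C ∧ C < 1 ∧ ∀ x₀ ∈ S.Γ a, ∀ Q ≥ 1, ∀ w z μ,
    P.IsADMMRun ρ x₀ Q w z μ → z 0 ∈ S.ZNhd a σz → μ 0 ∈ S.MNhd a σμ →
      S.err x₀ (z Q) (μ Q) ≤ C₀ * C ^ Q * S.err x₀ (z 0) (μ 0)

/-! ### The closed loop with a fixed number of iterations -/

variable (P)

/-- A run of the distributed MPC scheme with exactly `q` ADMM iterations in every MPC step and warm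
start; `xF k` is the actual predicted trajectory in step `k`. -/
structure ClosedLoop (ρ Δt : ℝ) (q : ℕ) (x₀ : P.State) (z₀ : P.ZTraj) (μ₀ : P.MTraj) where
  x : ℕ → P.State
  w : ℕ → ℕ → P.Primal
  z : ℕ → ℕ → P.ZTraj
  mu : ℕ → ℕ → P.MTraj
  xF : ℕ → ℝ → P.State
  x_zero : x 0 = x₀
  z_zero : z 0 0 = z₀
  mu_zero : mu 0 0 = μ₀
  admm : ∀ k, P.IsADMMRun ρ (x k) q (w k) (z k) (mu k)
  warm_z : ∀ k, z (k + 1) 0 = z k q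
  warm_mu : ∀ k, mu (k + 1) 0 = mu k q
  plant : ∀ k, P.IsPlantTraj (x k) (w k q).u (xF k)
  next : ∀ k, x (k + 1) = xF k Δt

/-- The continuous-time closed-loop state `x(kΔt + τ) = xF k τ`, `0 ≤ τ < Δt`. -/
def ClosedLoop.state {P : DMPC N} {ρ Δt : ℝ} {q : ℕ} {x₀ : P.State} {z₀ : P.ZTraj} {μ₀ : P.MTraj}
    (R : P.ClosedLoop ρ Δt q x₀ z₀ μ₀) (t : ℝ) : P.State :=
  R.xF ⌊t / Δt⌋₊ (t - ⌊t / Δt⌋₊ * Δt)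

end DMPC

end

/-! The proof is a small-gain argument for two coupled quantities: the optimal cost `J*(x)` at the
current state and the ADMM error `e` at the start of an MPC step.

Exact MPC would decrease `J*`. The tail of an optimal trajectory, prolonged inside the terminal set,
competes at the next state. Since the Lyapunov feedback may be discontinuous, the prolongation
samples it and holds its value, at an arbitrarily small loss (`Standing.exists_hold_step`,
`Standing.exists_continuation`). Hence `J*` drops by the stage cost over one sampling interval
(`OptData.J_next_le`), and this drop is at least `m‖x‖²` (`OptData.exists_mul_sq_le`). Conversely
`J*` is nonnegative, twice differentiable and zero at the origin, so it is at most `M‖x‖²` there.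
Small sublevel sets of `J*` are therefore small neighbourhoods of the origin, where one set of local
Lipschitz constants serves for all data.

Inexact ADMM perturbs this decrease. By the saddle property, the ADMM feedback evaluated at the
optimal coordination variables and multipliers returns the optimal control. Lipschitz continuity and
Grönwall then bound the deviation of the plant from the optimal trajectory by the error of the last
iterations (`OptData.exists_norm_response_sub_le`). R-linear convergence makes this at most `d = η
e`, with `η` as small as desired for large `q` (`OptData.exists_iterations`).

With `X = ‖x‖`, one step gives `J' ≤ J - (m/2) X² + A d²` and, by warm start and Lipschitz
dependence of the optimal data, `e' ≤ G (d + X)`. A small weight `θ`, followed by a small `η`, makes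
`J* + θ e²` contract by a fixed factor (`lyapunov_contraction`, `OptData.exists_contraction`). The
initial error need not be small: it is uniformly bounded on the neighbourhoods, and `η` is chosen
against that bound. Iteration yields all the estimates. -/

/-! ### Calculus on a compact interval -/

/-- Continuity argument: if a bound by `r` up to time `t` improves to a bound by `r' < r` at time
`t`, then the better bound holds on the whole interval. -/
lemma le_of_bootstrap {y : ℝ → ℝ} {a b r r' : ℝ} (hy : ContinuousOn y (Icc a b)) (hr : r' < r)
    (ha : y a ≤ r) (h : ∀ t ∈ Icc a b, (∀ s ∈ Icc a t, y s ≤ r) → y t ≤ r') :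
    ∀ t ∈ Icc a b, y t ≤ r' := by
  suffices H : ∀ t ∈ Icc a b, y t < r from
    fun t ht => h t ht fun s hs => (H s ⟨hs.1, hs.2.trans ht.2⟩).le
  by_contra! hcon
  obtain ⟨t₀, ht₀, hyt₀⟩ := hcon
  have hclosed : IsCompact (Icc a b ∩ y ⁻¹' Ici r) :=
    isCompact_Icc.of_isClosed_subset (hy.preimage_isClosed_of_isClosed isClosed_Icc isClosed_Ici)
      inter_subset_left
  obtain ⟨τ, ⟨hτ, hyτ⟩, hmin⟩ := hclosed.exists_isLeast ⟨t₀, ht₀, hyt₀⟩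
  have hyτ' : r ≤ y τ := hyτ
  -- At the first time where `r` is reached, the value is exactly `r`, and the bound by `r` holds up
  -- to then. The improved bound `r' < r` contradicts this.
  obtain ⟨s, hs, hys⟩ := intermediate_value_Icc hτ.1
    (hy.mono (Icc_subset_Icc_right hτ.2)) (⟨ha, hyτ'⟩ : r ∈ Icc (y a) (y τ))
  have hsτ : s = τ := le_antisymm hs.2 (hmin ⟨⟨hs.1, hs.2.trans hτ.2⟩, hys.ge⟩)
  subst hsτ
  have : y s ≤ r' := h s hτ fun σ hσ => by
    by_contra! hlt
    have hle : s ≤ σ := hmin ⟨⟨hσ.1, hσ.2.trans hτ.2⟩, hlt.le⟩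
    have : σ = s := le_antisymm hσ.2 hle
    rw [this, hys] at hlt
    exact lt_irrefl _ hlt
  linarith

/-- `max g c` is continuous and almost everywhere equal to `c`, hence equal to `c`. This turns `L^∞`
bounds on states into pointwise ones, which are needed at the sampling time. -/
lemma ContinuousOn.le_of_ae_le {g : ℝ → ℝ} {T c : ℝ} (hT : 0 < T) (hg : ContinuousOn g (Icc 0 T))
    (h : ∀ᵐ t ∂(volume.restrict (Icc 0 T)), g t ≤ c) : ∀ t ∈ Icc 0 T, g t ≤ c := by
  have key : EqOn (fun t => max (g t) c) (fun _ => c) (Icc 0 T) := by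
    refine Measure.eqOn_Icc_of_ae_eq volume hT.ne ?_ (hg.sup continuousOn_const)
      continuousOn_const
    filter_upwards [h] with t ht using max_eq_right ht
  intro t ht
  have := key ht

  exact (le_max_left _ _).trans this.le

/-- Integral form of Grönwall's inequality. -/
lemma le_mul_exp_of_le_integral {y : ℝ → ℝ} {K d T : ℝ} (hK : 1 ≤ K) (hd : 0 ≤ d)
    (hy : ContinuousOn y (Icc 0 T)) (hy0 : ∀ t ∈ Icc 0 T, 0 ≤ y t)
    (h : ∀ t ∈ Icc 0 T, y t ≤ ∫ s in (0 : ℝ)..t, (K * y s + d)) :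
    ∀ t ∈ Icc 0 T, y t ≤ d * Real.exp (K * T) := by
  intro t ht
  have hT : 0 ≤ T := ht.1.trans ht.2
  set g : ℝ → ℝ := fun s => K * IccExtend hT ((Icc 0 T).domRestrict y) s + d with hg
  have hgc : Continuous g := by
    have := (continuousOn_iff_continuous_domRestrict.1 hy).Icc_extend' (h := hT)
    fun_prop
  have hgy : ∀ s ∈ Icc 0 T, g s = K * y s + d := fun s hs => by
    simp only [hg, IccExtend_of_mem hT _ hs, domRestrict_apply]
  have hint : ∀ s ∈ Icc 0 T, ∫ σ in (0 : ℝ)..s, (K * y σ + d) = ∫ σ in (0 : ℝ)..s, g σ :=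
    fun s hs => intervalIntegral.integral_congr fun σ hσ => by
      rw [uIcc_of_le hs.1] at hσ
      exact (hgy σ ⟨hσ.1, hσ.2.trans hs.2⟩).symm
  have hnn : ∀ s ∈ Icc 0 T, 0 ≤ g s := fun s hs => by
    rw [hgy s hs]; have := hy0 s hs; positivity
  have hder : ∀ s, HasDerivAt (fun s => ∫ σ in (0 : ℝ)..s, g σ) (g s) s := fun s =>
    intervalIntegral.integral_hasDerivAt_right (hgc.intervalIntegrable _ _)
      (hgc.stronglyMeasurableAtFilter _ _) hgc.continuousAt
  have hInn : ∀ s ∈ Icc 0 T, 0 ≤ ∫ σ in (0 : ℝ)..s, g σ := fun s hs =>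
    intervalIntegral.integral_nonneg hs.1 fun σ hσ => hnn σ ⟨hσ.1, hσ.2.trans hs.2⟩
  have main := norm_le_gronwallBound_of_norm_deriv_right_le (f := fun s => ∫ σ in (0 : ℝ)..s, g σ)
    (f' := g) (δ := 0) (K := K) (ε := d) (a := 0) (b := T)
    (fun s _ => (hder s).continuousAt.continuousWithinAt)
    (fun s _ => (hder s).hasDerivWithinAt) (by simp)
    (fun s hs => by
      have hs' := Ico_subset_Icc_self hs
      rw [Real.norm_of_nonneg (hnn s hs'), Real.norm_of_nonneg (hInn s hs'), hgy s hs', ← hint s hs']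
      have := h s hs'
      gcongr) t ht
  rw [Real.norm_of_nonneg (hInn t ht), ← hint t ht, sub_zero,
    gronwallBound_of_K_ne_0 (by positivity)] at main
  refine (h t ht).trans (main.trans ?_)
  have h1 : Real.exp (K * t) ≤ Real.exp (K * T) := Real.exp_le_exp.2 (by have := ht.2; gcongr)
  have h0 : 1 ≤ Real.exp (K * t) := Real.one_le_exp (mul_nonneg (by positivity) ht.1)
  have h2 : d / K ≤ d := div_le_self hd hK
  have h3 : d / K * (Real.exp (K * t) - 1) ≤ d * (Real.exp (K * T)) :=
    mul_le_mul h2 (by linarith) (by linarith) hd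
  simpa using h3

/-- Continuous dependence of the solution of `ẋ = F(x, u)` on the control, for `F` Lipschitz
continuous on a bounded set. -/
lemma norm_sub_le_of_control_perturbation {E A : Type*} [NormedAddCommGroup E] [NormedSpace ℝ E]
    [NormedAddCommGroup A] {F : E → A → E} {B : Set A}
    {K R T d : ℝ} (hK : 1 ≤ K) (hd : 0 ≤ d)
    (hF : ∀ x ∈ Metric.closedBall (0 : E) (R + 1), ∀ y ∈ Metric.closedBall (0 : E) (R + 1),
      ∀ u ∈ B, ∀ v ∈ B, ‖F x u - F y v‖ ≤ K * (‖x - y‖ + ‖u - v‖))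
    {x₀ : E} {x₁ x₂ : ℝ → E} {u₁ u₂ : ℝ → A}
    (hx₁ : ContinuousOn x₁ (Icc 0 T)) (hx₂ : ContinuousOn x₂ (Icc 0 T))
    (hi₁ : IntegrableOn (fun s => F (x₁ s) (u₁ s)) (Icc 0 T))
    (hi₂ : IntegrableOn (fun s => F (x₂ s) (u₂ s)) (Icc 0 T))
    (he₁ : ∀ t ∈ Icc 0 T, x₁ t = x₀ + ∫ s in (0 : ℝ)..t, F (x₁ s) (u₁ s))
    (he₂ : ∀ t ∈ Icc 0 T, x₂ t = x₀ + ∫ s in (0 : ℝ)..t, F (x₂ s) (u₂ s))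
    (hR : ∀ t ∈ Icc 0 T, ‖x₁ t‖ ≤ R) (hu₁ : ∀ t ∈ Icc 0 T, u₁ t ∈ B)
    (hu₂ : ∀ t ∈ Icc 0 T, u₂ t ∈ B)
    (hu : ∀ᵐ s ∂(volume.restrict (Icc 0 T)), ‖u₂ s - u₁ s‖ ≤ d)
    (hsmall : K * d * Real.exp (K * T) ≤ 1 / 2) :
    ∀ t ∈ Icc 0 T, ‖x₂ t - x₁ t‖ ≤ K * d * Real.exp (K * T) := by
  intro t₀ ht₀
  have hT : 0 ≤ T := ht₀.1.trans ht₀.2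
  have hyc : ContinuousOn (fun t => ‖x₂ t - x₁ t‖) (Icc 0 T) := (hx₂.sub hx₁).norm
  have h00 : x₂ 0 - x₁ 0 = 0 := by
    rw [he₁ 0 ⟨le_rfl, hT⟩, he₂ 0 ⟨le_rfl, hT⟩]; simp
  -- The Lipschitz bound is available only within distance 1 of `x₁`. As long as `x₂` stays there,
  -- Grönwall gives a deviation of at most 1/2, so it never leaves.
  refine le_of_bootstrap (r := 1) hyc (by linarith) (by simp [h00]) ?_ t₀ ht₀
  intro t ht hle
  have hsub : Icc 0 t ⊆ Icc 0 T := Icc_subset_Icc_right ht.2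
  have hKt : Real.exp (K * t) ≤ Real.exp (K * T) := Real.exp_le_exp.2 (by have := ht.2; gcongr)
  have hb := le_mul_exp_of_le_integral (y := fun t => ‖x₂ t - x₁ t‖) (T := t) (d := K * d) hK
    (by positivity) (hyc.mono hsub) (fun _ _ => norm_nonneg _) ?_ t ⟨ht.1, le_rfl⟩
  · exact hb.trans (by gcongr)
  intro s hs
  have hs' := hsub hs
  have hsub' : Ioc 0 s ⊆ Icc 0 T := fun σ hσ => ⟨hσ.1.le, hσ.2.trans hs'.2⟩
  have hii : ∀ {g : ℝ → E}, IntegrableOn g (Icc 0 T) → IntervalIntegrable g volume 0 s :=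
    fun hg => (intervalIntegrable_iff_integrableOn_Ioc_of_le hs'.1).2 (hg.mono_set hsub')
  rw [he₁ s hs', he₂ s hs', add_sub_add_left_eq_sub,
    ← intervalIntegral.integral_sub (hii hi₂) (hii hi₁)]
  refine intervalIntegral.norm_integral_le_of_norm_le hs'.1 ?_ ?_
  · rw [ae_restrict_iff' measurableSet_Icc] at hu
    filter_upwards [hu] with σ hσ hmem
    have hmT := hsub' hmem
    have h1 : ‖x₂ σ - x₁ σ‖ ≤ 1 := hle σ ⟨hmem.1.le, hmem.2.trans hs.2⟩
    have hx1 := hR σ hmT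
    have hx2 : ‖x₂ σ‖ ≤ R + 1 := by
      have := norm_add_le (x₂ σ - x₁ σ) (x₁ σ)
      rw [sub_add_cancel] at this
      linarith
    refine (hF _ (by simpa using hx2) _ (by simp; linarith) _ (hu₂ σ hmT) _ (hu₁ σ hmT)).trans ?_
    rw [← mul_add]
    have := hσ hmT
    gcongr
  · refine ContinuousOn.intervalIntegrable ?_
    rw [uIcc_of_le hs'.1]
    exact (((hyc.mono (Icc_subset_Icc_right hs'.2)).const_mul K).add continuousOn_const)

namespace DMPC

variable {N : ℕ} {P : DMPC N}

/-! ### Basic consequences of the standing assumptions -/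

lemma Standing.contDiff_F (hP : P.Standing) :
    ContDiff ℝ 1 (fun p : P.State × P.Ctrl => P.F p.1 p.2) := by
  refine contDiff_piLp' 2 fun i => ?_
  have hc : ContDiff ℝ 1 (fun p : P.State × P.Ctrl => (P.hat p.1) i) :=
    contDiff_piLp' 2 fun j => (contDiff_piLp_apply (i := j.1) 2).comp contDiff_fst
  exact (hP.f_smooth i).comp (((contDiff_piLp_apply (i := i) 2).comp contDiff_fst).prodMk
    (((contDiff_piLp_apply (i := i) 2).comp contDiff_snd).prodMk hc))

lemma Standing.contDiff_stageCost (hP : P.Standing) :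
    ContDiff ℝ 1 (fun p : P.State × P.Ctrl => P.stageCost p.1 p.2) :=
  ContDiff.sum fun i _ => (hP.l_smooth i).comp
    (((contDiff_piLp_apply (i := i) 2).comp contDiff_fst).prodMk
      ((contDiff_piLp_apply (i := i) 2).comp contDiff_snd))

lemma Standing.contDiff_termCost (hP : P.Standing) : ContDiff ℝ 1 P.termCost :=
  ContDiff.sum fun i _ => (hP.V_smooth i).comp (contDiff_piLp_apply (i := i) 2)

lemma Standing.F_zero (hP : P.Standing) : P.F 0 0 = 0 := by
  ext1 i
  exact hP.f_zero i

lemma Standing.stageCost_nonneg (hP : P.Standing) (x : P.State) (u : P.Ctrl) :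
    0 ≤ P.stageCost x u := Finset.sum_nonneg fun i _ => hP.l_nonneg i _ _

lemma Standing.termCost_nonneg (hP : P.Standing) (x : P.State) : 0 ≤ P.termCost x :=
  Finset.sum_nonneg fun i _ => hP.V_nonneg i _

lemma Standing.termCost_zero (hP : P.Standing) : P.termCost 0 = 0 :=
  le_antisymm (by simpa using hP.V_upper 0) (hP.termCost_nonneg 0)

lemma Standing.stageCost_zero (hP : P.Standing) : P.stageCost 0 0 = 0 :=
  le_antisymm (by simpa using hP.l_upper 0 0) (hP.stageCost_nonneg 0 0)

lemma Standing.exists_ctrl_bound (hP : P.Standing) :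
    ∃ r : ℝ, ∀ u : P.Ctrl, (∀ i, u i ∈ P.U i) → u ∈ Metric.closedBall 0 r := by
  choose r hr using fun i => (hP.U_compact i).isBounded.exists_norm_le
  refine ⟨√(∑ i, r i ^ 2), fun u hu => ?_⟩
  rw [mem_closedBall_zero_iff, PiLp.norm_eq_of_L2]
  gcongr with i
  exact hr i _ (hu i)

lemma Standing.exists_lipschitz_F (hP : P.Standing) (R r : ℝ) :
    ∃ K : ℝ, 1 ≤ K ∧ ∀ x ∈ Metric.closedBall (0 : P.State) R,
      ∀ y ∈ Metric.closedBall (0 : P.State) R, ∀ u ∈ Metric.closedBall (0 : P.Ctrl) r,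
      ∀ v ∈ Metric.closedBall (0 : P.Ctrl) r,
        ‖P.F x u - P.F y v‖ ≤ K * (‖x - y‖ + ‖u - v‖) := by
  obtain ⟨K, hK⟩ := hP.contDiff_F.contDiffOn.exists_lipschitzOnWith one_ne_zero
    ((convex_closedBall (0 : P.State) R).prod (convex_closedBall (0 : P.Ctrl) r))
    ((isCompact_closedBall (0 : P.State) R).prod (isCompact_closedBall (0 : P.Ctrl) r))
  refine ⟨K + 1, by simp, fun x hx y hy u hu v hv => ?_⟩
  have h := hK.norm_sub_le (x := (x, u)) ⟨hx, hu⟩ (y := (y, v)) ⟨hy, hv⟩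
  refine h.trans ?_
  have h2 : ‖(x, u) - (y, v)‖ ≤ ‖x - y‖ + ‖u - v‖ := by
    rw [Prod.mk_sub_mk, Prod.norm_mk]
    exact max_le_add_of_nonneg (norm_nonneg _) (norm_nonneg _)
  have : (0 : ℝ) ≤ K := K.2
  nlinarith [norm_nonneg (x - y), norm_nonneg (u - v)]

lemma Standing.integrableOn_comp (hP : P.Standing) {E : Type*} [NormedAddCommGroup E]
    {G : P.State → P.Ctrl → E} (hG : Continuous fun p : P.State × P.Ctrl => G p.1 p.2)
    {x : ℝ → P.State} {u : ℝ → P.Ctrl} (hx : ContinuousOn x (Icc 0 P.T)) (hu : P.IsControl u) :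
    IntegrableOn (fun t => G (x t) (u t)) (Icc 0 P.T) := by
  obtain ⟨r, hr⟩ := hP.exists_ctrl_bound
  have hK := ((isCompact_Icc.image_of_continuousOn hx).prod
    (isCompact_closedBall (0 : P.Ctrl) r)).image hG
  obtain ⟨c, hc⟩ := hK.isBounded.exists_norm_le
  refine IntegrableOn.of_bound (by simp) ?_ c ?_
  · exact hG.comp_aestronglyMeasurable
      ((hx.aestronglyMeasurable measurableSet_Icc).prodMk hu.1)
  · rw [ae_restrict_iff' measurableSet_Icc]
    exact .of_forall fun t ht =>
      hc _ ⟨(x t, u t), ⟨⟨t, ht, rfl⟩, hr _ (hu.2 t ht)⟩, rfl⟩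

lemma Standing.integrableOn_F (hP : P.Standing) {x : ℝ → P.State} {u : ℝ → P.Ctrl}
    (hx : ContinuousOn x (Icc 0 P.T)) (hu : P.IsControl u) :
    IntegrableOn (fun t => P.F (x t) (u t)) (Icc 0 P.T) :=
  hP.integrableOn_comp hP.contDiff_F.continuous hx hu

lemma Standing.integrableOn_stageCost (hP : P.Standing) {x : ℝ → P.State} {u : ℝ → P.Ctrl}
    (hx : ContinuousOn x (Icc 0 P.T)) (hu : P.IsControl u) :
    IntegrableOn (fun t => P.stageCost (x t) (u t)) (Icc 0 P.T) :=
  hP.integrableOn_comp hP.contDiff_stageCost.continuous hx hu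

/-- The response depends only on the past of the control. -/
lemma Standing.eqOn_of_eqOn (hP : P.Standing) {x₀ : P.State} {x₁ x₂ : ℝ → P.State}
    {u₁ u₂ : ℝ → P.Ctrl} {s : ℝ} (hs : s ≤ P.T) (hu₁ : P.IsControl u₁) (hu₂ : P.IsControl u₂)
    (hx₁ : ContinuousOn x₁ (Icc 0 s)) (hx₂ : ContinuousOn x₂ (Icc 0 s))
    (hi₁ : IntegrableOn (fun s => P.F (x₁ s) (u₁ s)) (Icc 0 s))
    (hi₂ : IntegrableOn (fun s => P.F (x₂ s) (u₂ s)) (Icc 0 s))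
    (he₁ : ∀ t ∈ Icc 0 s, x₁ t = x₀ + ∫ s in (0 : ℝ)..t, P.F (x₁ s) (u₁ s))
    (he₂ : ∀ t ∈ Icc 0 s, x₂ t = x₀ + ∫ s in (0 : ℝ)..t, P.F (x₂ s) (u₂ s))
    (hu : EqOn u₁ u₂ (Icc 0 s)) : EqOn x₁ x₂ (Icc 0 s) := by
  obtain ⟨r, hr⟩ := hP.exists_ctrl_bound
  obtain ⟨R, hR⟩ := (isCompact_Icc.image_of_continuousOn hx₁).isBounded.exists_norm_le
  obtain ⟨K, hK, hF⟩ := hP.exists_lipschitz_F (R + 1) r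
  have hsub : Icc 0 s ⊆ Icc 0 P.T := Icc_subset_Icc_right hs
  intro t ht
  -- Control perturbation `d = 0`: the estimate becomes uniqueness.
  have h := norm_sub_le_of_control_perturbation hK le_rfl hF hx₁ hx₂ hi₁ hi₂ he₁ he₂
    (fun t ht => hR _ ⟨t, ht, rfl⟩) (fun t ht => hr _ (hu₁.2 t (hsub ht)))
    (fun t ht => hr _ (hu₂.2 t (hsub ht)))
    ((ae_restrict_iff' measurableSet_Icc).2 (.of_forall fun t ht => by simp [hu ht]))
    (by simp) t ht
  rw [mul_zero, zero_mul, norm_le_zero_iff, sub_eq_zero] at h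
  exact h.symm

lemma setIntegral_horizon (hT : 0 ≤ P.T) (g : ℝ → ℝ) :
    ∫ t, g t ∂P.horizon = ∫ t in (0 : ℝ)..P.T, g t := by
  rw [intervalIntegral.integral_of_le hT, integral_Icc_eq_integral_Ioc]

lemma Standing.intervalIntegrable (hP : P.Standing) {E : Type*} [NormedAddCommGroup E]
    {g : ℝ → E} (hg : IntegrableOn g (Icc 0 P.T)) {a b : ℝ} (ha : a ∈ Icc 0 P.T)
    (hb : b ∈ Icc 0 P.T) : IntervalIntegrable g volume a b :=
  ((intervalIntegrable_iff_integrableOn_Icc_of_le hP.T_pos.le).2 hg).mono_set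
    (by rw [uIcc_of_le hP.T_pos.le]; exact uIcc_subset_Icc ha hb)

lemma Standing.cost_nonneg (hP : P.Standing) (x : ℝ → P.State) (u : ℝ → P.Ctrl) :
    0 ≤ P.cost x u :=
  add_nonneg (hP.termCost_nonneg _) (integral_nonneg fun _ => hP.stageCost_nonneg _ _)

/-! ### Sample-and-hold controls from the control Lyapunov function -/

/-- Along a constant control taken from the Lyapunov feedback, `V` decreases up to an error that is
small compared to the step. -/
lemma Standing.exists_hold_step (hP : P.Standing) {β : ℝ}
    (hcomp : IsCompact {x : P.State | P.termCost x ≤ β}) {κV : P.State → P.Ctrl}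
    (hκ : ∀ x, P.termCost x ≤ β → (∀ i, κV x i ∈ P.U i) ∧
      fderiv ℝ P.termCost x (P.F x (κV x)) + P.stageCost x (κV x) ≤ 0)
    {ε : ℝ} (hε : 0 < ε) :
    ∃ h₀ : ℝ, 0 < h₀ ∧ ∀ (y : ℝ → P.State) (a b : ℝ), a ≤ b → b - a ≤ h₀ →
      ContinuousOn y (Icc a b) → P.termCost (y a) ≤ β →
      (∀ t ∈ Icc a b, y t = y a + ∫ s in a..t, P.F (y s) (κV (y a))) →
      P.termCost (y b) + ∫ t in a..b, P.stageCost (y t) (κV (y a)) ≤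
        P.termCost (y a) + ε * (b - a) := by
  obtain ⟨r, hr⟩ := hP.exists_ctrl_bound
  set Ω : Set P.State := {x | P.termCost x ≤ β}
  have hFc := hP.contDiff_F.continuous
  have hlc := hP.contDiff_stageCost.continuous
  have hVc : Continuous (fderiv ℝ P.termCost) := hP.contDiff_termCost.continuous_fderiv one_ne_zero
  have hDVF : Continuous fun p : P.State × P.Ctrl => fderiv ℝ P.termCost p.1 (P.F p.1 p.2) :=
    (hVc.comp continuous_fst).clm_apply hFc
  have hGc : Continuous fun p : P.State × P.Ctrl =>
      fderiv ℝ P.termCost p.1 (P.F p.1 p.2) + P.stageCost p.1 p.2 := hDVF.add hlc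
  have hK : IsCompact (Metric.cthickening 1 Ω ×ˢ Metric.closedBall (0 : P.Ctrl) r) :=
    hcomp.cthickening.prod (isCompact_closedBall _ _)
  obtain ⟨δ, hδ, hGδ⟩ := Metric.uniformContinuousOn_iff.1
    (hK.uniformContinuousOn_of_continuous hGc.continuousOn) ε hε
  obtain ⟨M, hM⟩ := (hK.image hFc).isBounded.exists_norm_le
  -- The bound 1 keeps the motion in the thickening of `Ω`; the bound `δ / 2` makes uniform
  -- continuity applicable.
  set δ' : ℝ := min (δ / 2) 1
  have hδ' : 0 < δ' := by positivity
  have hδ'1 : δ' ≤ 1 := min_le_right _ _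
  have hδ'2 : δ' ≤ δ / 2 := min_le_left _ _
  -- During a hold of this length, at speed at most `|M|`, the state moves by at most `δ' / 2`. The
  -- control is frozen, so the Lyapunov inequality at `y a` persists up to `ε` by continuity in the
  -- state alone; no continuity of `κV` is needed.
  refine ⟨δ' / (2 * (|M| + 1)), by positivity, fun y a b hab hba hy hya hdyn => ?_⟩
  set c := κV (y a)
  have hcb : c ∈ Metric.closedBall (0 : P.Ctrl) r := hr _ (hκ _ hya).1
  have hmem : ∀ s, ‖y s - y a‖ ≤ δ' →
      (y s, c) ∈ Metric.cthickening 1 Ω ×ˢ Metric.closedBall (0 : P.Ctrl) r := fun s hs =>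
    ⟨Metric.mem_cthickening_of_dist_le _ (y a) _ _ hya (by rw [dist_eq_norm]; linarith), hcb⟩
  have hclose : ∀ t ∈ Icc a b, ‖y t - y a‖ ≤ δ' / 2 := by
    refine le_of_bootstrap (r := δ') (hy.sub continuousOn_const).norm (by linarith)
      (by simpa using hδ'.le) fun t ht hle => ?_
    rw [hdyn t ht, add_sub_cancel_left]
    refine (intervalIntegral.norm_integral_le_of_norm_le_const (C := |M|) fun s hs => ?_).trans ?_
    · rw [uIoc_of_le ht.1] at hs
      exact (hM _ ⟨_, hmem s (hle s ⟨hs.1.le, hs.2⟩), rfl⟩).trans (le_abs_self _)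
    · have h1 : |t - a| ≤ δ' / (2 * (|M| + 1)) := by
        rw [abs_of_nonneg (by linarith [ht.1])]; linarith [ht.2]
      calc |M| * |t - a| ≤ (|M| + 1) * (δ' / (2 * (|M| + 1))) := by gcongr; linarith
        _ = δ' / 2 := by field_simp
  have hyc : ContinuousOn (fun s => (y s, c)) (Icc a b) := hy.prodMk continuousOn_const
  have hFy : ContinuousOn (fun s => P.F (y s) c) (Icc a b) := hFc.comp_continuousOn hyc
  have hderiv : ∀ t ∈ Ioo a b, HasDerivAt y (P.F (y t) c) t := by
    intro t ht
    have hnhds : Icc a b ∈ 𝓝 t := Icc_mem_nhds ht.1 ht.2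
    have h1 : HasDerivAt (fun t => y a + ∫ s in a..t, P.F (y s) c) (P.F (y t) c) t := by
      refine (intervalIntegral.integral_hasDerivAt_right ?_ ?_ (hFy.continuousAt hnhds)).const_add _
      · exact ContinuousOn.intervalIntegrable (by
          rw [uIcc_of_le ht.1.le]; exact hFy.mono (Icc_subset_Icc_right ht.2.le))
      · exact (hFy.mono Ioo_subset_Icc_self).stronglyMeasurableAtFilter isOpen_Ioo t ht
    refine h1.congr_of_eventuallyEq ?_
    filter_upwards [hnhds] with s hs using hdyn s hs
  have hcDVF : ContinuousOn (fun s => fderiv ℝ P.termCost (y s) (P.F (y s) c)) (Icc a b) :=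
    hDVF.comp_continuousOn hyc
  have hcl : ContinuousOn (fun s => P.stageCost (y s) c) (Icc a b) := hlc.comp_continuousOn hyc
  have hI1 := hcDVF.intervalIntegrable_of_Icc (μ := volume) hab
  have hI2 := hcl.intervalIntegrable_of_Icc (μ := volume) hab
  have hftc : ∫ t in a..b, fderiv ℝ P.termCost (y t) (P.F (y t) c) =
      P.termCost (y b) - P.termCost (y a) :=
    intervalIntegral.integral_eq_sub_of_hasDerivAt_of_le (f := fun t => P.termCost (y t)) hab
      (hP.contDiff_termCost.continuous.comp_continuousOn hy)
      (fun t ht => ((hP.contDiff_termCost.differentiable one_ne_zero _).hasFDerivAt).comp_hasDerivAt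
        t (hderiv t ht)) hI1
  have hle : ∫ t in a..b, (fderiv ℝ P.termCost (y t) (P.F (y t) c) + P.stageCost (y t) c) ≤
      ∫ _ in a..b, ε := by
    refine intervalIntegral.integral_mono_on hab (hI1.add hI2) (by simp) fun t ht => ?_
    have hd := hclose t ht
    have h1 := hGδ _ (hmem t (by linarith)) _ (hmem a (by simpa using hδ'.le)) (by
      rw [Prod.dist_eq, dist_self, max_eq_left dist_nonneg, dist_eq_norm]; simp only; linarith)
    rw [Real.dist_eq] at h1
    have h2 := (hκ _ hya).2
    have h3 := (abs_lt.1 h1).2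
    simp only at h3
    linarith
  rw [intervalIntegral.integral_add hI1 hI2, hftc, intervalIntegral.integral_const, smul_eq_mul]
    at hle
  linarith

lemma IsControl.piecewise {u : ℝ → P.Ctrl} (hu : P.IsControl u) (s : ℝ) {c : P.Ctrl}
    (hc : ∀ i, c i ∈ P.U i) : P.IsControl ((Iic s).piecewise u fun _ => c) := by
  refine ⟨.piecewise measurableSet_Iic hu.1.restrict aestronglyMeasurable_const,
    fun t ht i => ?_⟩
  by_cases h : t ∈ Iic s
  · rw [piecewise_eq_of_mem _ _ _ h]; exact hu.2 t ht i
  · rw [piecewise_eq_of_notMem _ _ _ h]; exact hc i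

/-- A control can be continued from any time at which the state lies well inside the terminal set
so that the remaining cost is at most the terminal cost, up to an arbitrarily small error. -/
lemma Standing.exists_continuation (hP : P.Standing) {β : ℝ} (hβ : P.IsCLF β) {ε a : ℝ}
    (hε : 0 < ε) (ha : a ∈ Icc 0 P.T) {x₀ : P.State} {u : ℝ → P.Ctrl} {x : ℝ → P.State}
    (hu : P.IsControl u) (hx : P.IsPlantTraj x₀ u x) (hV : P.termCost (x a) ≤ β / 2) :
    ∃ u' x', P.IsControl u' ∧ P.IsPlantTraj x₀ u' x' ∧ EqOn x' x (Icc 0 a) ∧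
      EqOn u' u (Icc 0 a) ∧
      P.termCost (x' P.T) + ∫ t in a..P.T, P.stageCost (x' t) (u' t) ≤ P.termCost (x a) + ε := by
  obtain ⟨hβ0, -, hcomp, κV, hκ⟩ := hβ
  set L : ℝ := P.T - a
  have hL : 0 ≤ L := sub_nonneg.2 ha.2
  -- The accumulated error is at most `β / 2`, so the slack in `hV` keeps every sampled state in the
  -- domain of `κV`, and at most `ε`, as claimed. The summand 1 covers `L = 0`.
  set ε₁ : ℝ := min ε (β / 2) / (L + 1)
  have hε₁ : 0 < ε₁ := by positivity
  have hε₁L : ε₁ * L ≤ min ε (β / 2) := by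
    have h1 : ε₁ * (L + 1) = min ε (β / 2) := by
      simp only [ε₁]; field_simp
    nlinarith
  obtain ⟨h₀, hh₀, hstep⟩ := hP.exists_hold_step hcomp hκ hε₁
  obtain ⟨n, hn⟩ := exists_nat_gt (L / h₀)
  have hn0 : (0 : ℝ) < n := lt_of_le_of_lt (by positivity) hn
  set h : ℝ := L / n
  have hh : 0 ≤ h := by positivity
  have hhh₀ : h ≤ h₀ := by
    rw [div_lt_iff₀ hh₀] at hn
    rw [div_le_iff₀ hn0]; linarith
  have hnh : n * h = L := by simp only [h]; field_simp
  have htk : ∀ k : ℕ, k ≤ n → a + k * h ∈ Icc a P.T := fun k hk => by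
    have h1 : (k : ℝ) * h ≤ n * h := by gcongr
    exact ⟨by have : 0 ≤ (k : ℝ) * h := by positivity
              linarith, by simp only [L] at hnh; linarith⟩
  have claim : ∀ k : ℕ, k ≤ n → ∃ u' x', P.IsControl u' ∧ P.IsPlantTraj x₀ u' x' ∧
      EqOn x' x (Icc 0 a) ∧ EqOn u' u (Icc 0 a) ∧
      P.termCost (x' (a + k * h)) + ∫ t in a..(a + k * h), P.stageCost (x' t) (u' t) ≤
        P.termCost (x a) + ε₁ * (k * h) := by
    intro k
    induction k with
    | zero => exact fun _ => ⟨u, x, hu, hx, fun _ _ => rfl, fun _ _ => rfl, by simp⟩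
    | succ k ih =>
      intro hk
      obtain ⟨u', x', hu', hx', hxx, huu, hcost⟩ := ih (by omega)
      have hs := htk k (by omega)
      have hb := htk (k + 1) hk
      set s : ℝ := a + k * h with hsdef
      set b : ℝ := a + (k + 1 : ℕ) * h with hbdef
      have hbs : b = s + h := by rw [hbdef, hsdef]; push_cast; ring
      have hs0 : s ∈ Icc 0 P.T := ⟨ha.1.trans hs.1, hs.2⟩
      have hb0 : b ∈ Icc 0 P.T := ⟨ha.1.trans hb.1, hb.2⟩
      have hVs : P.termCost (x' s) ≤ β := by
        have h1 : 0 ≤ ∫ t in a..s, P.stageCost (x' t) (u' t) :=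
          intervalIntegral.integral_nonneg hs.1 fun _ _ => hP.stageCost_nonneg _ _
        have h2 : ε₁ * (k * h) ≤ ε₁ * L := by
          have : s ≤ P.T := hs.2
          gcongr
          simp only [L]; linarith
        have := min_le_right ε (β / 2)
        linarith
      set c := κV (x' s) with hc
      -- From time `s` on, the control is replaced by the constant `c`. The response exists by
      -- assumption on the whole horizon, and causality identifies it with the old one up to `s`.
      have hu'' := hu'.piecewise s (hκ _ hVs).1
      obtain ⟨x'', hx''⟩ := hP.response x₀ _ hu''
      set u'' := (Iic s).piecewise u' fun _ => c
      have hsubs : Icc 0 s ⊆ Icc 0 P.T := Icc_subset_Icc_right hs.2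
      have hueq : EqOn u'' u' (Icc 0 s) := fun t ht => piecewise_eq_of_mem _ _ _ ht.2
      have hi'' := hP.integrableOn_F hx''.1 hu''
      have hxeq : EqOn x'' x' (Icc 0 s) :=
        hP.eqOn_of_eqOn hs.2 hu'' hu' (hx''.1.mono hsubs) (hx'.1.mono hsubs) (hi''.mono_set hsubs)
          ((hP.integrableOn_F hx'.1 hu').mono_set hsubs) (fun t ht => hx''.2 t (hsubs ht))
          (fun t ht => hx'.2 t (hsubs ht)) hueq
      have hsubas : Icc 0 a ⊆ Icc 0 s := Icc_subset_Icc_right hs.1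
      have hss : x'' s = x' s := hxeq ⟨hs0.1, le_rfl⟩
      have hcongr : ∀ {E : Type} [NormedAddCommGroup E] [NormedSpace ℝ E]
          (G : P.State → P.Ctrl → E) (t : ℝ), s ≤ t →
          ∫ σ in s..t, G (x'' σ) (u'' σ) = ∫ σ in s..t, G (x'' σ) c := by
        intro E _ _ G t hst
        refine intervalIntegral.integral_congr_ae (.of_forall fun σ hσ => ?_)
        rw [uIoc_of_le hst] at hσ
        rw [show u'' σ = c from piecewise_eq_of_notMem _ _ _ (by simpa using hσ.1)]
      have hdyn : ∀ t ∈ Icc s b, x'' t = x'' s + ∫ σ in s..t, P.F (x'' σ) (κV (x'' s)) := by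
        intro t ht
        have ht0 : t ∈ Icc 0 P.T := ⟨hs0.1.trans ht.1, ht.2.trans hb.2⟩
        rw [hss, ← hc, ← hcongr P.F t ht.1, ← hss, hx''.2 t ht0, hx''.2 s hs0, add_assoc,
          intervalIntegral.integral_add_adjacent_intervals
            (hP.intervalIntegrable hi'' ⟨le_rfl, hP.T_pos.le⟩ hs0)
            (hP.intervalIntegrable hi'' hs0 ht0)]
      have hle := hstep x'' s b (by linarith) (by linarith)
        (hx''.1.mono (Icc_subset_Icc hs0.1 hb.2)) (by rw [hss]; exact hVs) hdyn
      rw [hss, ← hc, ← hcongr P.stageCost b (by linarith)] at hle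
      refine ⟨u'', x'', hu'', hx'', fun t ht => (hxeq (hsubas ht)).trans (hxx ht),
        fun t ht => (hueq (hsubas ht)).trans (huu ht), ?_⟩
      have hl'' := hP.integrableOn_stageCost hx''.1 hu''
      rw [← intervalIntegral.integral_add_adjacent_intervals
        (hP.intervalIntegrable hl'' ha hs0) (hP.intervalIntegrable hl'' hs0 hb0)]
      have heq : ∫ t in a..s, P.stageCost (x'' t) (u'' t) =
          ∫ t in a..s, P.stageCost (x' t) (u' t) :=
        intervalIntegral.integral_congr fun σ hσ => by
          rw [uIcc_of_le hs.1] at hσ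
          have hσ' : σ ∈ Icc 0 s := ⟨ha.1.trans hσ.1, hσ.2⟩
          simp only [hueq hσ', hxeq hσ']
      rw [heq]
      have : ε₁ * ((k + 1 : ℕ) * h) = ε₁ * (k * h) + ε₁ * (b - s) := by
        rw [hbs]; push_cast; ring
      linarith
  obtain ⟨u', x', hu', hx', hxx, huu, hcost⟩ := claim n le_rfl
  refine ⟨u', x', hu', hx', hxx, huu, ?_⟩
  rw [hnh, show a + L = P.T by simp only [L]; ring] at hcost
  have := min_le_left ε (β / 2)
  linarith

/-- The tail of a trajectory that ends well inside the terminal set can be continued so that the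
cost decreases by the stage cost of the initial piece, up to an arbitrarily small error. -/
lemma Standing.exists_shift (hP : P.Standing) {β : ℝ} (hβ : P.IsCLF β) {ε Δt : ℝ}
    (hε : 0 < ε) (hΔt : 0 ≤ Δt) (hΔtT : Δt ≤ P.T) {x₀ : P.State} {u : ℝ → P.Ctrl}
    {x : ℝ → P.State} (hu : P.IsControl u) (hx : P.IsPlantTraj x₀ u x)
    (hV : P.termCost (x P.T) ≤ β / 2) :
    ∃ u' x', P.IsControl u' ∧ P.IsPlantTraj (x Δt) u' x' ∧
      P.cost x' u' ≤ P.cost x u - (∫ t in (0 : ℝ)..Δt, P.stageCost (x t) (u t)) + ε := by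
  have hT := hP.T_pos
  set a : ℝ := P.T - Δt
  have ha : a ∈ Icc 0 P.T := ⟨sub_nonneg.2 hΔtT, sub_le_self _ hΔt⟩
  have hsub : Icc 0 a ⊆ Icc 0 P.T := Icc_subset_Icc_right ha.2
  have h0 : (0 : ℝ) ∈ Icc 0 P.T := ⟨le_rfl, hT.le⟩
  have hTT : P.T ∈ Icc 0 P.T := ⟨hT.le, le_rfl⟩
  have hΔ : Δt ∈ Icc 0 P.T := ⟨hΔt, hΔtT⟩
  have hshift : ∀ t ∈ Icc 0 a, t + Δt ∈ Icc 0 P.T := fun t ht =>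
    ⟨add_nonneg ht.1 hΔt, by have := ht.2; simp only [a] at this; linarith⟩
  -- The value `u 0` after time `a` is a mere admissible filler, which the continuation overwrites.
  -- The `min` below likewise only keeps `xs` continuous on the full horizon.
  set us : ℝ → P.Ctrl := (Iic a).piecewise (fun t => u (t + Δt)) fun _ => u 0
  set xs : ℝ → P.State := fun t => x (min (t + Δt) P.T)
  have husm : P.IsControl us := by
    refine ⟨.piecewise measurableSet_Iic ?_ aestronglyMeasurable_const, fun t ht i => ?_⟩
    · refine (hu.1.comp_measurePreserving ((measurePreserving_add_right volume Δt).restrict_preimage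
        measurableSet_Icc)).mono_measure ?_
      rw [Measure.restrict_restrict measurableSet_Iic]
      exact Measure.restrict_mono (fun t ht => hshift t ⟨ht.2.1, ht.1⟩) le_rfl
    · by_cases h : t ∈ Iic a
      · simp only [us, piecewise_eq_of_mem _ _ _ h]; exact hu.2 _ (hshift t ⟨ht.1, h⟩) i
      · simp only [us, piecewise_eq_of_notMem _ _ _ h]; exact hu.2 0 h0 i
  have hxsc : ContinuousOn xs (Icc 0 P.T) := hx.1.comp (by fun_prop) fun t ht =>
    ⟨le_min (add_nonneg ht.1 hΔt) hT.le, min_le_right _ _⟩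
  have husa : ∀ t ∈ Icc 0 a, us t = u (t + Δt) := fun t ht => piecewise_eq_of_mem _ _ _ ht.2
  have hxsa : ∀ t ∈ Icc 0 a, xs t = x (t + Δt) := fun t ht => by
    simp only [xs, min_eq_left (hshift t ht).2]
  have hint : ∀ {E : Type} [NormedAddCommGroup E] [NormedSpace ℝ E]
      (G : P.State → P.Ctrl → E) (t : ℝ), t ∈ Icc 0 a →
      ∫ σ in (0 : ℝ)..t, G (xs σ) (us σ) = ∫ σ in Δt..(t + Δt), G (x σ) (u σ) := by
    intro E _ _ G t ht
    have := intervalIntegral.integral_comp_add_right (a := 0) (b := t)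
      (fun σ => G (x σ) (u σ)) Δt
    rw [zero_add] at this
    rw [← this]
    refine intervalIntegral.integral_congr fun σ hσ => ?_
    rw [uIcc_of_le ht.1] at hσ
    have hσ' : σ ∈ Icc 0 a := ⟨hσ.1, hσ.2.trans ht.2⟩
    simp only [husa σ hσ', hxsa σ hσ']
  have hFi := hP.integrableOn_F hx.1 hu
  have hdyn : ∀ t ∈ Icc 0 a, xs t = x Δt + ∫ s in (0 : ℝ)..t, P.F (xs s) (us s) := by
    intro t ht
    rw [hint P.F t ht, hxsa t ht, hx.2 _ (hshift t ht), hx.2 _ hΔ, add_assoc,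
      intervalIntegral.integral_add_adjacent_intervals (hP.intervalIntegrable hFi h0 hΔ)
        (hP.intervalIntegrable hFi hΔ (hshift t ht))]
  obtain ⟨xr, hxr⟩ := hP.response (x Δt) us husm
  have hxeq : EqOn xr xs (Icc 0 a) :=
    hP.eqOn_of_eqOn ha.2 husm husm (hxr.1.mono hsub) (hxsc.mono hsub)
      ((hP.integrableOn_F hxr.1 husm).mono_set hsub)
      ((hP.integrableOn_F hxsc husm).mono_set hsub)
      (fun t ht => hxr.2 t (hsub ht)) hdyn fun _ _ => rfl
  have haa : a ∈ Icc 0 a := ⟨ha.1, le_rfl⟩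
  have hxra : xr a = x P.T := by
    rw [hxeq haa, hxsa a haa]; simp [a]
  obtain ⟨u', x', hu', hx', hxx, huu, hcost⟩ :=
    hP.exists_continuation hβ hε ha husm hxr (by rw [hxra]; exact hV)
  refine ⟨u', x', hu', hx', ?_⟩
  have hli := hP.integrableOn_stageCost hx.1 hu
  have hli' := hP.integrableOn_stageCost hx'.1 hu'
  have heq : ∫ t in (0 : ℝ)..a, P.stageCost (x' t) (u' t) =
      ∫ t in Δt..P.T, P.stageCost (x t) (u t) := by
    have h1 := hint P.stageCost a haa
    rw [show a + Δt = P.T by simp [a]] at h1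
    rw [← h1]
    refine intervalIntegral.integral_congr fun σ hσ => ?_
    rw [uIcc_of_le ha.1] at hσ
    simp only [hxx hσ, huu hσ, hxeq hσ]
  have hsplit := intervalIntegral.integral_add_adjacent_intervals
    (hP.intervalIntegrable hli h0 hΔ) (hP.intervalIntegrable hli hΔ hTT)
  have hsplit' := intervalIntegral.integral_add_adjacent_intervals
    (hP.intervalIntegrable hli' h0 ha) (hP.intervalIntegrable hli' ha hTT)
  rw [hxra] at hcost
  simp only [cost]
  rw [setIntegral_horizon hT.le, setIntegral_horizon hT.le]
  linarith

/-- Decrease of the optimal cost along optimal trajectories, near the origin. -/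
lemma OptData.J_next_le {S : P.OptData} (hP : P.Standing) {β : ℝ} (hβ : P.IsCLF β) {Δt : ℝ}
    (hΔt : 0 ≤ Δt) (hΔtT : Δt ≤ P.T) (hopt : ∀ x₀, P.IsOptimal x₀ (S.x x₀) (S.u x₀))
    {x₀ : P.State} (hx₀ : S.J x₀ ≤ β / 2) :
    S.J (S.x x₀ Δt) ≤ S.J x₀ - ∫ t in (0 : ℝ)..Δt, P.stageCost (S.x x₀ t) (S.u x₀ t) := by
  refine le_of_forall_pos_le_add fun ε hε => ?_
  have hV : P.termCost (S.x x₀ P.T) ≤ β / 2 :=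
    (le_add_of_nonneg_right (integral_nonneg fun _ => hP.stageCost_nonneg _ _)).trans hx₀
  obtain ⟨u', x', hu', hx', hc⟩ :=
    hP.exists_shift hβ hε hΔt hΔtT (hopt x₀).1 (hopt x₀).2.1 hV
  exact ((hopt _).2.2 u' x' hu' hx').trans hc

end DMPC

/-! ### Growth near a minimum, and essential suprema -/

/-- A nonnegative twice differentiable function vanishing at the origin grows at most
quadratically there. -/
lemma ContDiffAt.exists_abs_sub_le_of_nonneg {E : Type*} [NormedAddCommGroup E]
    [NormedSpace ℝ E] {f : E → ℝ} (hf : ContDiffAt ℝ 2 f 0) (h0 : f 0 = 0) (hnn : ∀ x, 0 ≤ f x) :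
    ∃ r M : ℝ, 0 < r ∧ 0 < M ∧ ∀ x ∈ Metric.ball (0 : E) r, ∀ y ∈ Metric.ball (0 : E) r,
      |f y - f x| ≤ M * (‖x‖ + ‖y - x‖) * ‖y - x‖ := by
  have hd : ContDiffAt ℝ 1 (fderiv ℝ f) 0 := hf.fderiv_right (by norm_num)
  obtain ⟨K, t, ht, hK⟩ := hd.exists_lipschitzOnWith
  -- The origin is a minimum, so the Lipschitz derivative is bounded by `K ‖z‖`; the mean value
  -- inequality on the segment does the rest.
  have hmin : fderiv ℝ f 0 = 0 :=
    IsLocalMin.fderiv_eq_zero (.of_forall fun x => by rw [h0]; exact hnn x)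
  obtain ⟨r, hr, hball⟩ := Metric.mem_nhds_iff.1 (inter_mem ht (hf.eventually (by simp)))
  refine ⟨r, K + 1, hr, by positivity, fun x hx y hy => ?_⟩
  have hseg : segment ℝ x y ⊆ Metric.ball 0 r := (convex_ball 0 r).segment_subset hx hy
  have h := (convex_segment x y).norm_image_sub_le_of_norm_fderiv_le (𝕜 := ℝ) (f := f)
    (C := (K + 1) * (‖x‖ + ‖y - x‖))
    (fun z hz => ContDiffAt.differentiableAt (n := 2) (hball (hseg hz)).2 (by norm_num))
    (fun z hz => ?_)
    (left_mem_segment ℝ x y) (right_mem_segment ℝ x y)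
  · rwa [Real.norm_eq_abs] at h
  · have h1 := hK.norm_sub_le (hball (hseg hz)).1
      (hball (Metric.mem_ball_self hr)).1
    rw [hmin, sub_zero, sub_zero] at h1
    have h2 : ‖z‖ ≤ ‖x‖ + ‖y - x‖ := by
      have h3 : ‖z - x‖ ≤ ‖y - x‖ := by
        obtain ⟨θ, hθ, rfl⟩ := segment_eq_image' ℝ x y ▸ hz
        simp only [add_sub_cancel_left, norm_smul, Real.norm_of_nonneg hθ.1]
        exact mul_le_of_le_one_left (norm_nonneg _) hθ.2
      have := norm_add_le x (z - x)
      rw [add_sub_cancel] at this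
      linarith
    have hK0 : (0 : ℝ) ≤ K := K.2
    nlinarith [norm_nonneg z]

lemma MeasureTheory.Lp.ae_norm_le {α E : Type*} [MeasurableSpace α] {μ : Measure α}
    [NormedAddCommGroup E] (f : Lp E ∞ μ) : ∀ᵐ t ∂μ, ‖f t‖ ≤ ‖f‖ := by
  filter_upwards [ae_le_eLpNormEssSup (f := f) (μ := μ)] with t ht
  have hfin := Lp.eLpNorm_ne_top f
  rw [← eLpNorm_exponent_top] at ht
  rw [Lp.norm_def, ← toReal_enorm]
  exact ENNReal.toReal_mono hfin ht

namespace DMPC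

variable {N : ℕ} {P : DMPC N} {S : P.OptData} {ρ Δt a β σz σμ : ℝ}

/-! ### The optimal solution near the origin -/

/-- The gradient of `V` vanishes at its minimum, so the Lyapunov inequality at the origin forces
zero stage cost there, that is, `κV 0 = 0`. -/
lemma Standing.zero_mem_U (hP : P.Standing) (hβ : P.IsCLF β) (i : Fin N) :
    (0 : P.Ct i) ∈ P.U i := by
  obtain ⟨hβ0, -, -, κV, hκ⟩ := hβ
  obtain ⟨h1, h2⟩ := hκ 0 (by rw [hP.termCost_zero]; exact hβ0.le)
  have hmin : fderiv ℝ P.termCost 0 = 0 :=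
    IsLocalMin.fderiv_eq_zero (.of_forall fun x => by
      rw [hP.termCost_zero]; exact hP.termCost_nonneg x)
  rw [hmin, zero_apply, zero_add] at h2
  have h3 := (hP.l_lower 0 (κV 0)).trans h2
  have h4 : κV 0 = 0 := by
    have := hP.ml_pos
    have h5 : ‖κV 0‖ ^ 2 ≤ 0 := by
      rw [norm_zero, zero_pow two_ne_zero, zero_add] at h3
      exact nonpos_of_mul_nonpos_right h3 this
    exact norm_eq_zero.1 (pow_eq_zero_iff two_ne_zero |>.1 (le_antisymm h5 (sq_nonneg _)))
  simpa [h4] using h1 i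

lemma OptData.J_nonneg (hP : P.Standing) (x₀ : P.State) : 0 ≤ S.J x₀ := hP.cost_nonneg _ _

lemma OptData.J_zero (hP : P.Standing) (hβ : P.IsCLF β)
    (hopt : ∀ x₀, P.IsOptimal x₀ (S.x x₀) (S.u x₀)) : S.J 0 = 0 := by
  refine le_antisymm ?_ (OptData.J_nonneg hP 0)
  refine ((hopt 0).2.2 (fun _ => 0) (fun _ => 0)
    ⟨aestronglyMeasurable_const, fun _ _ i => hP.zero_mem_U hβ i⟩
    ⟨continuousOn_const, fun t _ => by simp [hP.F_zero]⟩).trans ?_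
  simp [cost, hP.termCost_zero, hP.stageCost_zero]

/-- Zero optimal cost forces zero stage cost almost everywhere, and the stage cost dominates `‖x‖²`.
-/
lemma OptData.x_zero (hP : P.Standing) (hβ : P.IsCLF β)
    (hopt : ∀ x₀, P.IsOptimal x₀ (S.x x₀) (S.u x₀)) : ∀ t ∈ Icc 0 P.T, S.x 0 t = 0 := by
  have hc := (hopt 0).2.1.1
  have h0 : ∫ t, P.stageCost (S.x 0 t) (S.u 0 t) ∂P.horizon = 0 := by
    refine le_antisymm ?_ (integral_nonneg fun _ => hP.stageCost_nonneg _ _)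
    have h1 := OptData.J_zero hP hβ hopt
    have h2 := hP.termCost_nonneg (S.x 0 P.T)
    simp only [OptData.J, cost] at h1
    linarith
  rw [integral_eq_zero_iff_of_nonneg (fun _ => hP.stageCost_nonneg _ _)
    (hP.integrableOn_stageCost hc (hopt 0).1)] at h0
  have h2 : ∀ᵐ t ∂(volume.restrict (Icc 0 P.T)), ‖S.x 0 t‖ ≤ 0 := by
    filter_upwards [h0] with t ht
    have h3 := hP.l_lower (S.x 0 t) (S.u 0 t)
    rw [ht, Pi.zero_apply] at h3
    have h4 := nonpos_of_mul_nonpos_right h3 hP.ml_pos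
    nlinarith [norm_nonneg (S.x 0 t), sq_nonneg ‖S.u 0 t‖]
  exact fun t ht => norm_le_zero_iff.1 (hc.norm.le_of_ae_le hP.T_pos h2 t ht)

/-- Since `z*` is the class of `x*`, regularity of `z*` in the initial state passes to `x*`,
pointwise in time. -/
lemma OptData.norm_x_sub_le (hP : P.Standing) (hopt : ∀ x₀, P.IsOptimal x₀ (S.x x₀) (S.u x₀))
    (hmult : S.HasMultipliers ρ a) {x y : P.State} (hx : x ∈ S.Γ a) (hy : y ∈ S.Γ a) :
    ∀ t ∈ Icc 0 P.T, ‖S.x x t - S.x y t‖ ≤ ‖S.z x - S.z y‖ := by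
  refine ((hopt x).2.1.1.sub (hopt y).2.1.1).norm.le_of_ae_le hP.T_pos ?_
  filter_upwards [hmult.z_eq x hx, hmult.z_eq y hy, Lp.ae_norm_le (S.z x - S.z y),
    Lp.coeFn_sub (S.z x) (S.z y)] with t h1 h2 h3 h4
  rwa [h4, Pi.sub_apply, h1, h2] at h3

lemma OptData.exists_norm_x_le (hP : P.Standing)
    (hopt : ∀ x₀, P.IsOptimal x₀ (S.x x₀) (S.u x₀)) (hΓ : IsCompact (S.Γ a))
    (hmult : S.HasMultipliers ρ a) :
    ∃ R : ℝ, ∀ x ∈ S.Γ a, ∀ t ∈ Icc 0 P.T, ‖S.x x t‖ ≤ R := by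
  obtain ⟨R, hR⟩ := (hΓ.image_of_continuousOn hmult.z_lip.continuousOn).isBounded.exists_norm_le
  refine ⟨R, fun x hx => (hopt x).2.1.1.norm.le_of_ae_le hP.T_pos ?_⟩
  filter_upwards [hmult.z_eq x hx, Lp.ae_norm_le (S.z x)] with t h1 h2
  rw [← h1]
  exact h2.trans (hR _ ⟨x, hx, rfl⟩)

/-- The optimal stage cost over an initial piece is bounded below by the squared norm of the
initial state. -/
lemma OptData.exists_mul_sq_le (hP : P.Standing) (hΔt : 0 < Δt) (hΔtT : Δt ≤ P.T)
    (hopt : ∀ x₀, P.IsOptimal x₀ (S.x x₀) (S.u x₀)) (hΓ : IsCompact (S.Γ a))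
    (hmult : S.HasMultipliers ρ a) :
    ∃ m : ℝ, 0 < m ∧ ∀ x ∈ S.Γ a,
      m * ‖x‖ ^ 2 ≤ ∫ t in (0 : ℝ)..Δt, P.stageCost (S.x x t) (S.u x t) := by
  obtain ⟨R, hR⟩ := OptData.exists_norm_x_le hP hopt hΓ hmult
  obtain ⟨r, hr⟩ := hP.exists_ctrl_bound
  obtain ⟨K, hK, hF⟩ := hP.exists_lipschitz_F (max R 0) (max r 0)
  have hml := hP.ml_pos
  -- From `x = x(t) - ∫ F` and `‖F‖ ≤ K (‖x‖ + ‖u‖)`, integration over `t` gives `Δt ‖x‖ ≤ B G`,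
  -- where `G` is the integral of `‖x‖ + ‖u‖`.
  set B : ℝ := 1 + K * Δt
  have hB : 0 < B := by positivity
  refine ⟨P.ml * Δt / (2 * B ^ 2), by positivity, fun x hx => ?_⟩
  obtain ⟨hu, hxt, -⟩ := hopt x
  have hsub : Icc 0 Δt ⊆ Icc 0 P.T := Icc_subset_Icc_right hΔtT
  have h0 : (0 : ℝ) ∈ Icc 0 P.T := ⟨le_rfl, hP.T_pos.le⟩
  have hΔ : Δt ∈ Icc 0 P.T := ⟨hΔt.le, hΔtT⟩
  set g : ℝ → ℝ := fun t => ‖S.x x t‖ + ‖S.u x t‖ with hg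
  have hgi : IntervalIntegrable g volume 0 Δt := hP.intervalIntegrable
    (hP.integrableOn_comp (G := fun x u => ‖x‖ + ‖u‖) (by fun_prop) hxt.1 hu) h0 hΔ
  have hxi : IntervalIntegrable (fun t => ‖S.x x t‖) volume 0 Δt := hP.intervalIntegrable
    (hP.integrableOn_comp (G := fun x _ => ‖x‖) (by fun_prop) hxt.1 hu) h0 hΔ
  have hli : IntervalIntegrable (fun t => P.stageCost (S.x x t) (S.u x t)) volume 0 Δt :=
    hP.intervalIntegrable (hP.integrableOn_stageCost hxt.1 hu) h0 hΔ
  set G : ℝ := ∫ t in (0 : ℝ)..Δt, g t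
  have hpoint : ∀ t ∈ Icc 0 Δt, ‖x‖ ≤ ‖S.x x t‖ + K * G := by
    intro t ht
    have htT := hsub ht
    have hFb : ‖∫ s in (0 : ℝ)..t, P.F (S.x x s) (S.u x s)‖ ≤ ∫ s in (0 : ℝ)..t, K * g s := by
      refine intervalIntegral.norm_integral_le_of_norm_le ht.1 (.of_forall fun s hs => ?_)
        ((hgi.mono_set (by
          rw [uIcc_of_le ht.1, uIcc_of_le hΔt.le]; exact Icc_subset_Icc_right ht.2)).const_mul K)
      have hsT : s ∈ Icc 0 P.T := ⟨hs.1.le, hs.2.trans htT.2⟩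
      have h1 := hF (S.x x s) (by simpa using Or.inl (hR x hx s hsT)) 0 (by simp) (S.u x s)
        (by simpa using Or.inl (by simpa using hr _ (hu.2 s hsT))) 0 (by simp)
      simpa [hP.F_zero] using h1
    have hmono : ∫ s in (0 : ℝ)..t, K * g s ≤ K * G := by
      rw [intervalIntegral.integral_const_mul]
      gcongr
      exact intervalIntegral.integral_mono_interval le_rfl ht.1 ht.2
        (.of_forall fun s => by simp only [hg]; positivity) hgi
    have heq : x = S.x x t - ∫ s in (0 : ℝ)..t, P.F (S.x x s) (S.u x s) := by
      rw [hxt.2 t htT, add_sub_cancel_right]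
    have := norm_sub_le (S.x x t) (∫ s in (0 : ℝ)..t, P.F (S.x x s) (S.u x s))
    rw [← heq] at this
    linarith
  have hint1 : Δt * ‖x‖ ≤ B * G := by
    have h1 : ∫ _ in (0 : ℝ)..Δt, ‖x‖ ≤ ∫ t in (0 : ℝ)..Δt, (‖S.x x t‖ + K * G) :=
      intervalIntegral.integral_mono_on hΔt.le (by simp) (hxi.add (by simp)) hpoint
    rw [intervalIntegral.integral_add hxi (by simp), intervalIntegral.integral_const,
      intervalIntegral.integral_const, smul_eq_mul, smul_eq_mul, sub_zero] at h1
    have h2 : ∫ t in (0 : ℝ)..Δt, ‖S.x x t‖ ≤ G :=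
      intervalIntegral.integral_mono_on hΔt.le hxi hgi fun t _ => by simp [hg]
    simp only [B]
    linarith
  set I : ℝ := ∫ t in (0 : ℝ)..Δt, P.stageCost (S.x x t) (S.u x t)
  have hI : 0 ≤ I := intervalIntegral.integral_nonneg hΔt.le fun _ _ => hP.stageCost_nonneg _ _
  rcases eq_or_ne x 0 with rfl | hx0
  · simpa using hI
  have hxpos : 0 < ‖x‖ := norm_pos_iff.2 hx0
  -- Pointwise `p + q ≤ s + (p² + q²) / (2 s)` replaces Cauchy–Schwarz. With this `s`, the first
  -- term contributes `Δt ‖x‖ / 2`, which is absorbed on the left.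
  set s : ℝ := ‖x‖ / (2 * B) with hs
  have hspos : 0 < s := by positivity
  have hint2 : G ≤ Δt * s + I / (2 * s * P.ml) := by
    have h1 : G ≤ ∫ t in (0 : ℝ)..Δt, (s + (2 * s * P.ml)⁻¹ * P.stageCost (S.x x t) (S.u x t)) := by
      refine intervalIntegral.integral_mono_on hΔt.le hgi
        ((by simp : IntervalIntegrable (fun _ => s) volume 0 Δt).add (hli.const_mul _))
        fun t _ => ?_
      have h2 := hP.l_lower (S.x x t) (S.u x t)
      have h3 : (2 * s * P.ml)⁻¹ * (P.ml * (‖S.x x t‖ ^ 2 + ‖S.u x t‖ ^ 2)) ≤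
          (2 * s * P.ml)⁻¹ * P.stageCost (S.x x t) (S.u x t) := by gcongr
      refine le_trans ?_ (add_le_add_right h3 s)
      have h4 : s + (2 * s * P.ml)⁻¹ * (P.ml * (‖S.x x t‖ ^ 2 + ‖S.u x t‖ ^ 2)) - g t =
          ((‖S.x x t‖ - s) ^ 2 + (‖S.u x t‖ - s) ^ 2) / (2 * s) := by
        simp only [hg]; field_simp; ring
      have h5 : 0 ≤ ((‖S.x x t‖ - s) ^ 2 + (‖S.u x t‖ - s) ^ 2) / (2 * s) := by positivity
      linarith
    rw [intervalIntegral.integral_add (by simp) (hli.const_mul _),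
      intervalIntegral.integral_const_mul, intervalIntegral.integral_const, smul_eq_mul,
      sub_zero] at h1
    rw [div_eq_inv_mul]
    exact h1
  have h3 : Δt * ‖x‖ ≤ B * (Δt * s + I / (2 * s * P.ml)) := hint1.trans (by gcongr)
  have h4 : B * (Δt * s + I / (2 * s * P.ml)) = Δt * ‖x‖ / 2 + B ^ 2 * I / (‖x‖ * P.ml) := by
    rw [hs]; field_simp
  rw [h4] at h3
  have h5 : Δt * ‖x‖ / 2 ≤ B ^ 2 * I / (‖x‖ * P.ml) := by linarith
  rw [le_div_iff₀ (by positivity)] at h5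
  rw [div_mul_eq_mul_div, div_le_iff₀ (by positivity)]
  nlinarith

/-- Together with `OptData.exists_mul_sq_le` this makes `J*` positive definite, even if `m_V = 0`.
-/
lemma OptData.stageCost_integral_le_J (hP : P.Standing) (hΔt : 0 ≤ Δt) (hΔtT : Δt ≤ P.T)
    (hopt : ∀ x₀, P.IsOptimal x₀ (S.x x₀) (S.u x₀)) (x : P.State) :
    ∫ t in (0 : ℝ)..Δt, P.stageCost (S.x x t) (S.u x t) ≤ S.J x := by
  have h := intervalIntegral.integral_mono_interval (μ := volume) (c := 0) (d := P.T) le_rfl hΔt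
    hΔtT (f := fun t => P.stageCost (S.x x t) (S.u x t))
    (.of_forall fun _ => hP.stageCost_nonneg _ _)
    (hP.intervalIntegrable (hP.integrableOn_stageCost (hopt x).2.1.1 (hopt x).1)
      ⟨le_rfl, hP.T_pos.le⟩ ⟨hP.T_pos.le, le_rfl⟩)
  rw [OptData.J, cost, setIntegral_horizon hP.T_pos.le]
  have := hP.termCost_nonneg (S.x x P.T)
  linarith

/-! ### Error estimates for one MPC step -/

/-- The own components `μ_{ii}` of a multiplier value. -/
def MultVal.own (m : P.MultVal) : P.State := WithLp.toLp 2 fun i => (m i).fst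

lemma MultVal.norm_own_le (m : P.MultVal) : ‖MultVal.own m‖ ≤ ‖m‖ := by
  rw [PiLp.norm_eq_of_L2, PiLp.norm_eq_of_L2]
  gcongr with i
  exact WithLp.norm_fst_le _ _

/-- The predicted states of an ADMM step are controlled by the errors of the coordination variables
and multipliers before and after the step. -/
lemma IsADMMStep.norm_x_sub_le (hP : P.Standing) (hρ : 0 < ρ)
    (hopt : ∀ x₀, P.IsOptimal x₀ (S.x x₀) (S.u x₀)) (hmult : S.HasMultipliers ρ a)
    {x : P.State} (hx : x ∈ S.Γ a) {z z' : P.ZTraj} {μ μ' : P.MTraj} {w : P.Primal}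
    (h : P.IsADMMStep ρ x z μ w z' μ') {e : ℝ} (he : S.err x z μ ≤ e) (he' : S.err x z' μ' ≤ e) :
    ∀ t ∈ Icc 0 P.T, ‖w.x t - S.x x t‖ ≤ (1 + 2 / ρ) * e := by
  refine (h.w_min.1.2.2.1.sub (hopt x).2.1.1).norm.le_of_ae_le hP.T_pos ?_
  filter_upwards [h.mu_own, hmult.z_eq x hx, Lp.ae_norm_le (z' - S.z x), Lp.coeFn_sub z' (S.z x),
    Lp.ae_norm_le (μ' - μ), Lp.coeFn_sub μ' μ] with t h1 h2 h3 h4 h5 h6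
  have hz : ‖z' - S.z x‖ ≤ e := (le_max_left _ _).trans he'
  have hμ : ‖μ' - μ‖ ≤ 2 * e := by
    have h7 : ‖μ' - S.mu x‖ ≤ e := (le_max_right _ _).trans he'
    have h8 : ‖μ - S.mu x‖ ≤ e := (le_max_right _ _).trans he
    have h9 := norm_sub_le (μ' - S.mu x) (μ - S.mu x)
    rw [sub_sub_sub_cancel_right] at h9
    linarith
  rw [h4, Pi.sub_apply, h2] at h3
  rw [h6, Pi.sub_apply] at h5
  -- The multiplier update, solved for the state predicted by ADMM.
  have key : w.x t - S.x x t = (z' t - S.x x t) - ρ⁻¹ • MultVal.own (μ' t - μ t) := by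
    ext1 i
    have h10 : MultVal.own (μ' t - μ t) i = ρ • (z' t i - w.x t i) := by
      simp [MultVal.own, h1 i]
    rw [PiLp.sub_apply, PiLp.sub_apply, PiLp.smul_apply, PiLp.sub_apply, h10, smul_smul,
      inv_mul_cancel₀ hρ.ne', one_smul]
    abel
  rw [key]
  refine (norm_sub_le _ _).trans ?_
  rw [norm_smul, Real.norm_of_nonneg (by positivity)]
  have h11 := (MultVal.norm_own_le (μ' t - μ t)).trans (h5.trans hμ)
  have h12 : ρ⁻¹ * ‖MultVal.own (μ' t - μ t)‖ ≤ ρ⁻¹ * (2 * e) := by gcongr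
  have h13 : (1 + 2 / ρ) * e = e + ρ⁻¹ * (2 * e) := by field_simp
  rw [h13]
  linarith

lemma OptData.zero_mem_Γ (hP : P.Standing) (hβ : P.IsCLF β)
    (hopt : ∀ x₀, P.IsOptimal x₀ (S.x x₀) (S.u x₀)) (ha : 0 ≤ a) : (0 : P.State) ∈ S.Γ a := by
  rw [OptData.Γ, mem_ofPred_eq, OptData.J_zero hP hβ hopt]
  exact ha

lemma OptData.z_mem_ZNhd (hσz : 0 < σz) {x : P.State} (hx : x ∈ S.Γ a) :
    S.z x ∈ S.ZNhd a σz := Metric.self_subset_thickening hσz _ ⟨x, hx, rfl⟩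

lemma OptData.mu_mem_MNhd (hσμ : 0 < σμ) {x : P.State} (hx : x ∈ S.Γ a) :
    S.mu x ∈ S.MNhd a σμ := Metric.self_subset_thickening hσμ _ ⟨x, hx, rfl⟩

/-- Near the origin, the response of the plant to the control of an ADMM iteration differs from the
optimal trajectory by at most a multiple of the errors of that iteration. -/
lemma OptData.exists_norm_response_sub_le (hP : P.Standing) (hβ : P.IsCLF β) (hσz : 0 < σz)
    (hσμ : 0 < σμ) (ha : 0 ≤ a) (hopt : ∀ x₀, P.IsOptimal x₀ (S.x x₀) (S.u x₀))
    (hΓ : IsCompact (S.Γ a)) (hmult : S.HasMultipliers ρ a)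
    (hreg : S.IsRegular ρ Δt a σz σμ) :
    ∃ r δ D : ℝ, 0 < r ∧ 0 < δ ∧ 0 < D ∧ ∀ x ∈ S.Γ a, ‖x‖ < r → ∀ z ∈ S.ZNhd a σz,
      ∀ μ ∈ S.MNhd a σμ, ∀ w, P.IsPrimalMin ρ x z μ w → ∀ d, 0 ≤ d → d ≤ δ → S.err x z μ ≤ d →
      (∀ t ∈ Icc 0 P.T, ‖w.x t - S.x x t‖ ≤ d) → ∀ xF, P.IsPlantTraj x w.u xF →
      ∀ τ ∈ Icc 0 P.T, ‖xF τ - S.x x τ‖ ≤ D * d := by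
  obtain ⟨κ, hκL, hκ⟩ := hreg.feedback_admm
  have h0Γ := OptData.zero_mem_Γ hP hβ hopt ha
  obtain ⟨Kκ, W, hW, hLip⟩ := hκL (0, S.z 0, S.mu 0, 0)
    ⟨mem_univ _, OptData.z_mem_ZNhd hσz h0Γ, OptData.mu_mem_MNhd hσμ h0Γ, h0Γ⟩
  obtain ⟨η, hη, hηW⟩ := Metric.mem_nhdsWithin_iff.1 hW
  obtain ⟨rz, hrz, hz⟩ := Metric.continuousWithinAt_iff.1
    (hmult.z_lip.continuousOn 0 h0Γ) (η / 2) (by positivity)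
  obtain ⟨rμ, hrμ, hμ⟩ := Metric.continuousWithinAt_iff.1
    (hmult.mu_lip.continuousOn 0 h0Γ) (η / 2) (by positivity)
  obtain ⟨R, hR⟩ := OptData.exists_norm_x_le hP hopt hΓ hmult
  obtain ⟨rU, hrU⟩ := hP.exists_ctrl_bound
  obtain ⟨K, hK, hF⟩ := hP.exists_lipschitz_F (R + 1) rU
  set D : ℝ := K * Kκ * Real.exp (K * P.T) + 1
  have hKκ : (0 : ℝ) ≤ Kκ := Kκ.2
  have hD : 0 < D := by positivity
  -- These radii place both the iterate and the optimal arguments of the feedback in its Lipschitz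
  -- neighbourhood `W`. The bound `1 / (2 * D)` is the smallness required by the perturbation
  -- estimate.
  refine ⟨min (min rz rμ) η, min (η / 2) (1 / (2 * D)), D, by positivity, by positivity, hD, ?_⟩
  intro x hx hxr z hzN μ hμN w hw d hd hdδ herr hwx xF hxF
  have hxz : ‖x‖ < rz := hxr.trans_le ((min_le_left _ _).trans (min_le_left _ _))
  have hxμ : ‖x‖ < rμ := hxr.trans_le ((min_le_left _ _).trans (min_le_right _ _))
  have hxη : ‖x‖ < η := hxr.trans_le (min_le_right _ _)
  have hdη : d ≤ η / 2 := hdδ.trans (min_le_left _ _)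
  have hzx : dist (S.z x) (S.z 0) < η / 2 := hz hx (by simpa using hxz)
  have hμx : dist (S.mu x) (S.mu 0) < η / 2 := hμ hx (by simpa using hxμ)
  have hzd : dist z (S.z x) ≤ d := by rw [dist_eq_norm]; exact (le_max_left _ _).trans herr
  have hμd : dist μ (S.mu x) ≤ d := by rw [dist_eq_norm]; exact (le_max_right _ _).trans herr
  -- The optimal solution is itself a primal minimizer, so the same feedback law produces `u*`, and
  -- the two controls can be compared through its arguments.
  have hmin : P.IsPrimalMin ρ x (S.z x) (S.mu x) (S.w x) :=
    ⟨(hmult.saddle x hx).1, fun w' hw' => (hmult.saddle x hx).2.2 w' _ hw'⟩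
  have hzΓ : S.z x ∈ S.ZNhd a σz := OptData.z_mem_ZNhd hσz hx
  have hμΓ : S.mu x ∈ S.MNhd a σμ := OptData.mu_mem_MNhd hσμ hx
  have hu : ∀ᵐ s ∂(volume.restrict (Icc 0 P.T)), ‖w.u s - S.u x s‖ ≤ Kκ * d := by
    filter_upwards [hκ x hx z hzN μ hμN w hw, hκ x hx _ hzΓ _ hμΓ _ hmin,
      ae_restrict_mem measurableSet_Icc] with s h1 h2 hs
    have hxs : ‖S.x x s‖ < η / 2 := by
      have h3 := OptData.norm_x_sub_le hP hopt hmult hx h0Γ s hs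
      rw [OptData.x_zero hP hβ hopt s hs, sub_zero, ← dist_eq_norm] at h3
      exact h3.trans_lt hzx
    have hwxs : dist (w.x s) (S.x x s) ≤ d := by rw [dist_eq_norm]; exact hwx s hs
    have hm1 : (w.x s, z, μ, x) ∈ W := by
      refine hηW ⟨?_, mem_univ _, hzN, hμN, hx⟩
      simp only [Metric.mem_ball, Prod.dist_eq]
      refine max_lt ?_ (max_lt ?_ (max_lt ?_ (by simpa using hxη)))
      · have := dist_triangle (w.x s) (S.x x s) 0
        rw [dist_zero_right] at this
        rw [dist_zero_right] at *
        linarith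
      · have := dist_triangle z (S.z x) (S.z 0)
        linarith
      · have := dist_triangle μ (S.mu x) (S.mu 0)
        linarith
    have hm2 : (S.x x s, S.z x, S.mu x, x) ∈ W := by
      refine hηW ⟨?_, mem_univ _, hzΓ, hμΓ, hx⟩
      simp only [Metric.mem_ball, Prod.dist_eq]
      refine max_lt ?_ (max_lt (by linarith) (max_lt (by linarith) (by simpa using hxη)))
      rw [dist_zero_right]; linarith
    have h3 := (hLip s hs).dist_le_mul _ hm1 _ hm2
    have h2' : S.u x s = κ s (S.x x s, S.z x, S.mu x, x) := h2
    rw [h1, h2', ← dist_eq_norm]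
    refine h3.trans (mul_le_mul_of_nonneg_left ?_ hKκ)
    simp only [Prod.dist_eq]
    exact max_le hwxs (max_le hzd (max_le hμd (by simpa using hd)))
  have hexp := Real.exp_pos (K * P.T)
  have hDd : K * (Kκ * d) * Real.exp (K * P.T) ≤ D * d := by
    simp only [D]; nlinarith
  have hDd2 : D * d ≤ 1 / 2 := by
    have h1 : d ≤ 1 / (2 * D) := hdδ.trans (min_le_right _ _)
    calc D * d ≤ D * (1 / (2 * D)) := by gcongr
      _ = 1 / 2 := by field_simp
  intro τ hτ
  refine (norm_sub_le_of_control_perturbation hK (by positivity) hF (hopt x).2.1.1 hxF.1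
    (hP.integrableOn_F (hopt x).2.1.1 (hopt x).1) (hP.integrableOn_F hxF.1 hw.1.1)
    (hopt x).2.1.2 hxF.2 (hR x hx) (fun t ht => hrU _ ((hopt x).1.2 t ht))
    (fun t ht => hrU _ (hw.1.1.2 t ht)) hu (hDd.trans hDd2) τ hτ).trans hDd

/-- The optimal data over the compact `Γ_a` form bounded sets, and so do their neighbourhoods. No
smallness of the initialization is needed because of this bound. -/
lemma OptData.exists_err_le (hΓ : IsCompact (S.Γ a)) (hmult : S.HasMultipliers ρ a) (σz σμ : ℝ) :
    ∃ E : ℝ, 0 < E ∧ ∀ x ∈ S.Γ a, ∀ z ∈ S.ZNhd a σz, ∀ μ ∈ S.MNhd a σμ, S.err x z μ ≤ E := by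
  have hzb := (hΓ.image_of_continuousOn hmult.z_lip.continuousOn).isBounded
  have hμb := (hΓ.image_of_continuousOn hmult.mu_lip.continuousOn).isBounded
  obtain ⟨A, hA⟩ := hzb.exists_norm_le
  obtain ⟨A', hA'⟩ := (hzb.thickening (δ := σz)).exists_norm_le
  obtain ⟨B, hB⟩ := hμb.exists_norm_le
  obtain ⟨B', hB'⟩ := (hμb.thickening (δ := σμ)).exists_norm_le
  refine ⟨max (max (A' + A) (B' + B)) 1, by positivity, fun x hx z hz μ hμ => ?_⟩
  refine le_trans (max_le_max ?_ ?_) (le_max_left _ _)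
  · exact (norm_sub_le _ _).trans (add_le_add (hA' z hz) (hA _ ⟨x, hx, rfl⟩))
  · exact (norm_sub_le _ _).trans (add_le_add (hB' μ hμ) (hB _ ⟨x, hx, rfl⟩))

/-- With sufficiently many ADMM iterations, near the origin, both the error of the final iterate and
the deviation of the predicted trajectory are small relative to the initial error. -/
lemma OptData.exists_iterations (hP : P.Standing) (hβ : P.IsCLF β) (hρ : 0 < ρ) (hσz : 0 < σz)
    (hσμ : 0 < σμ) (ha : 0 ≤ a) (hopt : ∀ x₀, P.IsOptimal x₀ (S.x x₀) (S.u x₀))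
    (hΓ : IsCompact (S.Γ a)) (hmult : S.HasMultipliers ρ a)
    (hreg : S.IsRegular ρ Δt a σz σμ) (hbdd : S.ADMMBounded ρ a σz σμ)
    (hconv : S.RLinear ρ a σz σμ) :
    ∃ r : ℝ, 0 < r ∧ ∀ η : ℝ, 0 < η → ∃ q : ℕ, 0 < q ∧
      ∀ x ∈ S.Γ a, ‖x‖ < r → ∀ w z μ, P.IsADMMRun ρ x q w z μ → z 0 ∈ S.ZNhd a σz →
        μ 0 ∈ S.MNhd a σμ → S.err x (z q) (μ q) ≤ η * S.err x (z 0) (μ 0) ∧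
        ∀ xF, P.IsPlantTraj x (w q).u xF → ∀ τ ∈ Icc 0 P.T,
          ‖xF τ - S.x x τ‖ ≤ η * S.err x (z 0) (μ 0) := by
  obtain ⟨r, δ, D, hr, hδ, hD, hresp⟩ :=
    OptData.exists_norm_response_sub_le hP hβ hσz hσμ ha hopt hΓ hmult hreg
  obtain ⟨E, hE, herrE⟩ := OptData.exists_err_le hΓ hmult σz σμ
  obtain ⟨C₀, C, hC₀, hC, hC1, hlin⟩ := hconv
  refine ⟨r, hr, fun η hη => ?_⟩
  set B : ℝ := 1 + 2 / ρ
  have hB : 1 ≤ B := by simp only [B]; have : 0 < 2 / ρ := by positivity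
                        linarith
  have hB0 : 0 < B := by positivity
  -- `B ε e` bounds the errors entering the response estimate: it must stay below `δ` for every `e ≤
  -- E`, and after multiplication by `D` below `η e`.
  obtain ⟨ε, hε, hεη, hεB, hεδ⟩ : ∃ ε : ℝ, 0 < ε ∧ ε ≤ η ∧ D * (B * ε) ≤ η ∧ B * (ε * E) ≤ δ := by
    refine ⟨min η (min (η / (D * B)) (δ / (B * E))), by positivity, min_le_left _ _, ?_, ?_⟩
    · calc D * (B * min η (min (η / (D * B)) (δ / (B * E)))) ≤ D * (B * (η / (D * B))) := by
            gcongr; exact (min_le_right _ _).trans (min_le_left _ _)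
        _ = η := by field_simp
    · calc B * (min η (min (η / (D * B)) (δ / (B * E))) * E) ≤ B * (δ / (B * E) * E) := by
            gcongr; exact (min_le_right _ _).trans (min_le_right _ _)
        _ = δ := by field_simp
  obtain ⟨n, hn⟩ := exists_pow_lt_of_lt_one (div_pos hε hC₀) hC1
  -- The last control depends on the iterate before it, and its state on the errors both before and
  -- after the last step. So the iterates `n + 1` and `n + 2` must both be accurate.
  refine ⟨n + 2, by omega, fun x hx hxr w z μ hrun hz hμ => ?_⟩
  have hpow : ∀ k, n ≤ k → C₀ * C ^ k ≤ ε := fun k hk => by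
    have h1 : C ^ k ≤ C ^ n := pow_le_pow_of_le_one hC hC1.le hk
    rw [lt_div_iff₀ hC₀] at hn
    nlinarith
  set e := S.err x (z 0) (μ 0)
  have he : 0 ≤ e := (norm_nonneg _).trans (le_max_left _ _)
  have herr : ∀ k, n ≤ k → 1 ≤ k → k ≤ n + 2 → S.err x (z k) (μ k) ≤ ε * e := fun k hk h1 h2 =>
    (hlin x hx k h1 w z μ (fun q hq => hrun q (by omega)) hz hμ).trans (by
      have := hpow k hk; gcongr)
  have hlast := herr (n + 2) (by omega) (by omega) le_rfl
  have hprev := herr (n + 1) (by omega) (by omega) (by omega)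
  refine ⟨hlast.trans (by gcongr), fun xF hxF τ hτ => ?_⟩
  have hstep := hrun (n + 1) (by omega)
  have hmem := hbdd.bounded x hx (n + 1) w z μ (fun q hq => hrun q (by omega)) hz hμ
  have hwx := IsADMMStep.norm_x_sub_le hP hρ hopt hmult hx hstep hprev hlast
  have hεe : 0 ≤ ε * e := by positivity
  have h := hresp x hx hxr _ hmem.1 _ hmem.2 _ hstep.w_min (B * (ε * e)) (by positivity)
    ((by have := herrE x hx _ hz _ hμ; gcongr : B * (ε * e) ≤ B * (ε * E)).trans hεδ)
    (hprev.trans (le_mul_of_one_le_left hεe hB)) hwx xF hxF τ hτ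
  refine h.trans ?_
  calc D * (B * (ε * e)) = D * (B * ε) * e := by ring
    _ ≤ η * e := by gcongr

end DMPC

/-! ### Arithmetic of the small-gain argument -/

lemma exists_small_gain {c₁ c₂ b₀ b₁ b₂ E : ℝ} (hb₀ : 0 < b₀) (hb₁ : 0 < b₁) (hb₂ : 0 < b₂) :
    ∃ η : ℝ, 0 < η ∧ η ≤ 1 ∧ η * E < b₀ ∧ c₁ * η ^ 2 ≤ b₁ ∧ c₂ * (η * E) ^ 2 ≤ b₂ := by
  have hlim : ∀ f : ℝ → ℝ, Continuous f → f 0 = 0 → ∀ b, 0 < b → ∀ᶠ η in 𝓝[>] (0 : ℝ), f η < b :=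
    fun f hf h0 b hb =>
      ((hf.tendsto 0).mono_left nhdsWithin_le_nhds).eventually_lt_const (by rwa [h0])
  have hpos : ∀ᶠ η in 𝓝[>] (0 : ℝ), 0 < η := self_mem_nhdsWithin
  obtain ⟨η, h1, h2, h3, h4, h5⟩ := (hpos.and
    ((hlim (fun η => η) (by fun_prop) rfl 1 one_pos).and
    ((hlim (fun η => η * E) (by fun_prop) (by simp) b₀ hb₀).and
    ((hlim (fun η => c₁ * η ^ 2) (by fun_prop) (by simp) b₁ hb₁).and
    (hlim (fun η => c₂ * (η * E) ^ 2) (by fun_prop) (by simp) b₂ hb₂))))).exists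
  exact ⟨η, h1, h2.le, h3, h4.le, h5.le⟩

/-- Young's inequality: half of the decrease absorbs the mixed term `M L X d`. -/
lemma decrease_of_perturbation {J J' m M L X d : ℝ} (hm : 0 < m)
    (h : J' ≤ J - m * X ^ 2 + M * (L * X + d) * d) :
    J' ≤ J - m / 2 * X ^ 2 + (M ^ 2 * L ^ 2 / (2 * m) + M) * d ^ 2 := by
  have h5 : m / 2 * X ^ 2 + (M ^ 2 * L ^ 2 / (2 * m) + M) * d ^ 2 - M * (L * X + d) * d =
      (m * X - M * L * d) ^ 2 / (2 * m) := by
    field_simp; ring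
  have h6 : 0 ≤ (m * X - M * L * d) ^ 2 / (2 * m) := by positivity
  linarith

/-- The remaining decrease is at least the fraction `m / (2 M)` of `J`, and the perturbation is at
most the same fraction of the level `b`. -/
lemma level_invariant {J J' m M A X d D b : ℝ} (hm : 0 < m) (hmM : m ≤ M) (hA : 0 ≤ A)
    (hd : 0 ≤ d) (hdD : d ≤ D) (hJM : J ≤ M * X ^ 2) (hJb : J ≤ b)
    (hD : A * D ^ 2 ≤ m / (2 * M) * b) (h : J' ≤ J - m / 2 * X ^ 2 + A * d ^ 2) : J' ≤ b := by
  have hM : 0 < M := hm.trans_le hmM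
  have h1 : A * d ^ 2 ≤ A * D ^ 2 := by gcongr
  have h2 : m / (2 * M) * J ≤ m / (2 * M) * (M * X ^ 2) := by gcongr
  have h3 : (1 - m / (2 * M)) * J ≤ (1 - m / (2 * M)) * b := by
    refine mul_le_mul_of_nonneg_left hJb ?_
    rw [sub_nonneg, div_le_one (by positivity)]
    linarith
  have h4 : m / (2 * M) * (M * X ^ 2) = m / 2 * X ^ 2 := by field_simp
  linarith

/-- The weight `θ` is so small that the new error costs at most `(m/4) (d² + X²)`, half of the
available decrease in `X`. All terms in `d²` are then paid by half of `θ e²`, which is the condition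
on `η`. -/
lemma lyapunov_contraction {J J' m M A X d e e' η θ G : ℝ} (hm : 0 < m) (hM : 0 < M)
    (hJ : 0 ≤ J) (hJM : J ≤ M * X ^ 2) (hG : 0 < G) (hθ : 0 < θ) (hθG : θ * (2 * G ^ 2) = m / 4)
    (hη : (A + m / 4) * η ^ 2 ≤ θ / 2) (hd : d = η * e) (he' : 0 ≤ e') (hee : e' ≤ G * (d + X))
    (h : J' ≤ J - m / 2 * X ^ 2 + A * d ^ 2) :
    J' + θ * e' ^ 2 ≤ max (1 - m / (4 * M)) (1 / 2) * (J + θ * e ^ 2) := by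
  have h5 := pow_le_pow_left₀ he' hee 2
  have h6 : (G * (d + X)) ^ 2 ≤ 2 * G ^ 2 * (d ^ 2 + X ^ 2) := by
    have h7 : 0 ≤ G ^ 2 * (d - X) ^ 2 := by positivity
    have h8 : 2 * G ^ 2 * (d ^ 2 + X ^ 2) - (G * (d + X)) ^ 2 = G ^ 2 * (d - X) ^ 2 := by ring
    linarith
  have h1 : θ * e' ^ 2 ≤ m / 4 * (d ^ 2 + X ^ 2) := by
    rw [← hθG, mul_assoc]
    exact mul_le_mul_of_nonneg_left (h5.trans h6) hθ.le
  have h2 : (A + m / 4) * d ^ 2 ≤ 1 / 2 * (θ * e ^ 2) := by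
    have h7 := mul_le_mul_of_nonneg_right hη (sq_nonneg e)
    rw [hd, mul_pow, ← mul_assoc]
    linarith
  have h3 : m / (4 * M) * J ≤ m / (4 * M) * (M * X ^ 2) := by gcongr
  have h4 : m / (4 * M) * (M * X ^ 2) = m / 4 * X ^ 2 := by field_simp
  have h7 : (1 - m / (4 * M)) * J ≤ max (1 - m / (4 * M)) (1 / 2) * J := by
    gcongr; exact le_max_left _ _
  have h8 : 1 / 2 * (θ * e ^ 2) ≤ max (1 - m / (4 * M)) (1 / 2) * (θ * e ^ 2) := by
    gcongr; exact le_max_right _ _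
  linarith

/-- The left side dominates `(L X + d)²`, the squared bound on the plant trajectory, so the Lyapunov
function controls the state between samples as well. -/
lemma trajectory_sq_bound {J m L X d e θ : ℝ} (hm : 0 < m) (hθ : 0 < θ)
    (hJ : m * X ^ 2 ≤ J) (hd : 0 ≤ d) (hde : d ≤ e) :
    2 * L ^ 2 * X ^ 2 + 2 * d ^ 2 ≤ (2 * L ^ 2 / m + 2 / θ) * (J + θ * e ^ 2) := by
  have hJ0 : 0 ≤ J := le_trans (by positivity) hJ
  have h0 : d ^ 2 ≤ e ^ 2 := pow_le_pow_left₀ hd hde 2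
  have h1 : 2 * L ^ 2 / m * (m * X ^ 2) ≤ 2 * L ^ 2 / m * J := by gcongr
  have h2 : 0 ≤ 2 * L ^ 2 / m * (θ * e ^ 2) := by positivity
  have h3 : 0 ≤ 2 / θ * J := by positivity
  have h4 : 2 * L ^ 2 / m * (m * X ^ 2) = 2 * L ^ 2 * X ^ 2 := by field_simp
  have h5 : 2 / θ * (θ * e ^ 2) = 2 * e ^ 2 := by field_simp
  linarith

namespace DMPC

variable {N : ℕ} {P : DMPC N} {S : P.OptData} {ρ Δt a β σz σμ : ℝ}

/-! ### Contraction of the combined Lyapunov function -/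

lemma OptData.err_nonneg (x : P.State) (z : P.ZTraj) (μ : P.MTraj) : 0 ≤ S.err x z μ :=
  (norm_nonneg _).trans (le_max_left _ _)

/-- Near the origin `z*`, `μ*` and `x*` are Lipschitz continuous with a common constant. -/
lemma OptData.exists_common_lipschitz (hP : P.Standing) (hβ : P.IsCLF β) (ha : 0 ≤ a)
    (hopt : ∀ x₀, P.IsOptimal x₀ (S.x x₀) (S.u x₀)) (hmult : S.HasMultipliers ρ a) :
    ∃ r L : ℝ, 0 < r ∧ 1 ≤ L ∧
      (∀ x ∈ S.Γ a, ‖x‖ < r → ∀ y ∈ S.Γ a, ‖y‖ < r → ∀ z μ,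
        S.err y z μ ≤ S.err x z μ + L * ‖y - x‖) ∧
      ∀ x ∈ S.Γ a, ‖x‖ < r → ∀ t ∈ Icc 0 P.T, ‖S.x x t‖ ≤ L * ‖x‖ := by
  have h0Γ := OptData.zero_mem_Γ hP hβ hopt ha
  obtain ⟨Kz, Wz, hWz, hz⟩ := hmult.z_lip h0Γ
  obtain ⟨Kμ, Wμ, hWμ, hμ⟩ := hmult.mu_lip h0Γ
  obtain ⟨r, hr, hrW⟩ := Metric.mem_nhdsWithin_iff.1 (inter_mem hWz hWμ)
  have hKz : (0 : ℝ) ≤ Kz := Kz.2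
  have hKμ : (0 : ℝ) ≤ Kμ := Kμ.2
  have hmem : ∀ x ∈ S.Γ a, ‖x‖ < r → x ∈ Wz ∩ Wμ := fun x hx hxr => hrW ⟨by simpa using hxr, hx⟩
  have hzL : ∀ x ∈ S.Γ a, ‖x‖ < r → ∀ y ∈ S.Γ a, ‖y‖ < r →
      ‖S.z x - S.z y‖ ≤ (1 + Kz + Kμ) * ‖x - y‖ := fun x hx hxr y hy hyr =>
    (hz.norm_sub_le (hmem x hx hxr).1 (hmem y hy hyr).1).trans (by gcongr; linarith)
  have hμL : ∀ x ∈ S.Γ a, ‖x‖ < r → ∀ y ∈ S.Γ a, ‖y‖ < r →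
      ‖S.mu x - S.mu y‖ ≤ (1 + Kz + Kμ) * ‖x - y‖ := fun x hx hxr y hy hyr =>
    (hμ.norm_sub_le (hmem x hx hxr).2 (hmem y hy hyr).2).trans (by gcongr; linarith)
  refine ⟨r, 1 + Kz + Kμ, hr, by linarith, fun x hx hxr y hy hyr z μ => ?_, fun x hx hxr t ht => ?_⟩
  · have h1 := hzL x hx hxr y hy hyr
    have h2 := hμL x hx hxr y hy hyr
    rw [norm_sub_rev x y] at h1 h2
    refine max_le ?_ ?_
    · rw [← sub_add_sub_cancel z (S.z x) (S.z y)]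
      exact (norm_add_le _ _).trans (add_le_add (le_max_left _ _) h1)
    · rw [← sub_add_sub_cancel μ (S.mu x) (S.mu y)]
      exact (norm_add_le _ _).trans (add_le_add (le_max_right _ _) h2)
  · have h1 := OptData.norm_x_sub_le hP hopt hmult hx h0Γ t ht
    rw [OptData.x_zero hP hβ hopt t ht, sub_zero] at h1
    simpa using h1.trans (hzL x hx hxr 0 h0Γ (by simpa using hr))

/-- One MPC step contracts `J*(x) + θ e²`, where `e` is the ADMM error at the beginning of the
step, on a sublevel set of `J*`. -/
lemma OptData.exists_contraction (hP : P.Standing) (hβ : P.IsCLF β) (hρ : 0 < ρ) (hΔt : 0 < Δt)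
    (hΔtT : Δt ≤ P.T) (hσz : 0 < σz) (hσμ : 0 < σμ) (ha : 0 < a)
    (hopt : ∀ x₀, P.IsOptimal x₀ (S.x x₀) (S.u x₀))
    (hΓ : IsCompact (S.Γ a)) (hmult : S.HasMultipliers ρ a)
    (hreg : S.IsRegular ρ Δt a σz σμ) (hbdd : S.ADMMBounded ρ a σz σμ)
    (hconv : S.RLinear ρ a σz σμ) :
    ∃ α' : ℝ, 0 < α' ∧ α' ≤ a ∧ ∃ q : ℕ, 0 < q ∧ ∃ θ g H M : ℝ,
      0 < θ ∧ 0 < g ∧ g < 1 ∧ 0 < H ∧ 0 < M ∧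
      ∀ x ∈ S.Γ α', S.J x ≤ M * ‖x‖ ^ 2 ∧ ∀ w z μ, P.IsADMMRun ρ x q w z μ →
        z 0 ∈ S.ZNhd a σz → μ 0 ∈ S.MNhd a σμ → ∀ xF, P.IsPlantTraj x (w q).u xF →
        xF Δt ∈ S.Γ α' ∧
        S.J (xF Δt) + θ * S.err (xF Δt) (z q) (μ q) ^ 2 ≤
          g * (S.J x + θ * S.err x (z 0) (μ 0) ^ 2) ∧
        ∀ τ ∈ Icc 0 P.T,
          ‖xF τ - S.x x τ‖ ^ 2 ≤ H * (S.J x + θ * S.err x (z 0) (μ 0) ^ 2) ∧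
          ‖xF τ‖ ^ 2 ≤ H * (S.J x + θ * S.err x (z 0) (μ 0) ^ 2) := by
  obtain ⟨m, hm, hmJ⟩ := OptData.exists_mul_sq_le hP hΔt hΔtT hopt hΓ hmult
  obtain ⟨r₁, hr₁, hiter⟩ := OptData.exists_iterations hP hβ hρ hσz hσμ ha.le hopt hΓ hmult hreg
    hbdd hconv
  obtain ⟨r₂, L, hr₂, hL, herrL, hxL⟩ := OptData.exists_common_lipschitz hP hβ ha.le hopt hmult
  obtain ⟨E, hE, herrE⟩ := OptData.exists_err_le hΓ hmult σz σμ
  obtain ⟨r₃, M₀, hr₃, hM₀, hJ₀⟩ := (hreg.J_smooth 0 (OptData.zero_mem_Γ hP hβ hopt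
    ha.le)).exists_abs_sub_le_of_nonneg (OptData.J_zero hP hβ hopt) (OptData.J_nonneg hP)
  set M : ℝ := max M₀ m
  have hM : 0 < M := hM₀.trans_le (le_max_left _ _)
  have hmM : m ≤ M := le_max_right _ _
  have hJ : ∀ x ∈ Metric.ball (0 : P.State) r₃, ∀ y ∈ Metric.ball (0 : P.State) r₃,
      S.J y ≤ S.J x + M * (‖x‖ + ‖y - x‖) * ‖y - x‖ := fun x hx y hy => by
    have h1 := (abs_le.1 (hJ₀ x hx y hy)).2
    have h2 : M₀ * (‖x‖ + ‖y - x‖) * ‖y - x‖ ≤ M * (‖x‖ + ‖y - x‖) * ‖y - x‖ := by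
      gcongr; exact le_max_left _ _
    linarith
  obtain ⟨hβ0, -⟩ := id hβ
  have hL0 : 0 < L := by linarith
  set r : ℝ := min (min r₁ r₂) (r₃ / (2 * L))
  have hr : 0 < r := by positivity
  -- The level `β / 2` gives the decrease of `J*`; the level `m r² / 4` forces `‖x‖ < r`, where all
  -- local estimates hold.
  set α' : ℝ := min (min a (β / 2)) (m * r ^ 2 / 4)
  have hα' : 0 < α' := by positivity
  have hα'a : α' ≤ a := (min_le_left _ _).trans (min_le_left _ _)
  have hα'β : α' ≤ β / 2 := (min_le_left _ _).trans (min_le_right _ _)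
  have hsubΓ : ∀ x ∈ S.Γ α', x ∈ S.Γ a := fun x hx => le_trans hx hα'a
  have hmJ' : ∀ x ∈ S.Γ a, m * ‖x‖ ^ 2 ≤ S.J x := fun x hx =>
    (hmJ x hx).trans (OptData.stageCost_integral_le_J hP hΔt.le hΔtT hopt x)
  have hnorm : ∀ x ∈ S.Γ α', ‖x‖ < r := fun x hx => by
    have h1 : m * ‖x‖ ^ 2 ≤ m * r ^ 2 / 4 :=
      (hmJ' x (hsubΓ x hx)).trans (le_trans hx (min_le_right _ _))
    have h2 : ‖x‖ ^ 2 < r ^ 2 := by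
      have : m * ‖x‖ ^ 2 < m * r ^ 2 := by nlinarith [mul_pos hm (pow_pos hr 2)]
      exact lt_of_mul_lt_mul_left this hm.le
    exact lt_of_pow_lt_pow_left₀ 2 hr.le h2
  set A : ℝ := M ^ 2 * L ^ 2 / (2 * m) + M
  have hA : 0 < A := by positivity
  -- Bounds the next initial error, at most `d + L ‖y - x‖` with `‖y - x‖ ≤ d + (1 + L) ‖x‖`.
  set G : ℝ := (1 + L) ^ 2
  have hG : 0 < G := by positivity
  set θ : ℝ := m / (8 * G ^ 2)
  have hθ : 0 < θ := by positivity
  have hθG : θ * (2 * G ^ 2) = m / 4 := by simp only [θ]; field_simp; norm_num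
  -- `η`, and through it `q`, comes last. It must beat `θ` for contraction, `α'` for invariance
  -- under every error up to `E`, and `r₃` to keep the plant where the quadratic bound on `J*`
  -- holds.
  obtain ⟨η, hη, hη1, hηr, hηθ, hηα⟩ := exists_small_gain (c₁ := A + m / 4) (c₂ := A) (E := E)
    (b₀ := r₃ / 2) (b₁ := θ / 2) (b₂ := m / (2 * M) * α') (by positivity) (by positivity)
    (by positivity)
  obtain ⟨q, hq, hstep⟩ := hiter η hη
  set g : ℝ := max (1 - m / (4 * M)) (1 / 2)
  have hg1 : g < 1 := max_lt (by have : 0 < m / (4 * M) := by positivity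
                                 linarith) (by norm_num)
  set H : ℝ := 2 * L ^ 2 / m + 2 / θ
  have hH : 0 < H := by positivity
  refine ⟨α', hα', hα'a, q, hq, θ, g, H, M, hθ, lt_max_of_lt_right (by norm_num), hg1, hH, hM,
    fun x hx => ?_⟩
  have hxa := hsubΓ x hx
  have hxr := hnorm x hx
  have hx₁ : ‖x‖ < r₁ := hxr.trans_le ((min_le_left _ _).trans (min_le_left _ _))
  have hx₂ : ‖x‖ < r₂ := hxr.trans_le ((min_le_left _ _).trans (min_le_right _ _))
  have hLx : L * ‖x‖ < r₃ / 2 := by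
    have h1 : ‖x‖ < r₃ / (2 * L) := hxr.trans_le (min_le_right _ _)
    rw [lt_div_iff₀ (by positivity)] at h1
    linarith
  have hx₃ : ‖x‖ < r₃ := by nlinarith [norm_nonneg x]
  have hJM : S.J x ≤ M * ‖x‖ ^ 2 := by
    have h1 := hJ 0 (by simpa using hr₃) x (by simpa using hx₃)
    rw [OptData.J_zero hP hβ hopt] at h1
    simp only [norm_zero, sub_zero, zero_add] at h1
    linarith
  refine ⟨hJM, fun w z μ hrun hz hμ xF hxF => ?_⟩
  obtain ⟨hlast, hdev⟩ := hstep x hxa hx₁ w z μ hrun hz hμ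
  replace hdev := hdev xF hxF
  set e := S.err x (z 0) (μ 0) with he_def
  have he : 0 ≤ e := OptData.err_nonneg _ _ _
  have heE : e ≤ E := herrE x hxa _ hz _ hμ
  set d : ℝ := η * e with hd_def
  have hd : 0 ≤ d := by positivity
  have hdr : d < r₃ / 2 := lt_of_le_of_lt (mul_le_mul_of_nonneg_left heE hη.le) hηr
  have hde : d ≤ e := mul_le_of_le_one_left he hη1
  have hΔ : Δt ∈ Icc 0 P.T := ⟨hΔt.le, hΔtT⟩
  have hX := norm_nonneg x
  have hx1 : ‖S.x x Δt‖ ≤ L * ‖x‖ := hxL x hxa hx₂ Δt hΔ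
  have hyx1 : ‖xF Δt - S.x x Δt‖ ≤ d := hdev Δt hΔ
  have hy : ‖xF Δt‖ ≤ L * ‖x‖ + d := by
    have := norm_add_le (S.x x Δt) (xF Δt - S.x x Δt)
    rw [add_sub_cancel] at this
    linarith
  have hJx := OptData.J_nonneg (S := S) hP x
  have hdecr : S.J (xF Δt) ≤ S.J x - m / 2 * ‖x‖ ^ 2 + A * d ^ 2 := by
    refine decrease_of_perturbation (L := L) hm ?_
    have h1 := hJ (S.x x Δt) (by simpa using by linarith) (xF Δt) (by simpa using by linarith)
    have h2 := OptData.J_next_le hP hβ hΔt.le hΔtT hopt (le_trans hx hα'β)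
    have h3 := hmJ x hxa
    have h4 : M * (‖S.x x Δt‖ + ‖xF Δt - S.x x Δt‖) * ‖xF Δt - S.x x Δt‖ ≤
        M * (L * ‖x‖ + d) * d := by gcongr
    linarith
  have hyΓ : xF Δt ∈ S.Γ α' :=
    level_invariant hm hmM hA.le hd (mul_le_mul_of_nonneg_left heE hη.le) hJM hx hηα hdecr
  have herr : S.err (xF Δt) (z q) (μ q) ≤ G * (d + ‖x‖) := by
    have h1 := herrL x hxa hx₂ (xF Δt) (hsubΓ _ hyΓ)
      ((hnorm _ hyΓ).trans_le ((min_le_left _ _).trans (min_le_right _ _))) (z q) (μ q)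
    have h2 : ‖xF Δt - x‖ ≤ d + (1 + L) * ‖x‖ := by
      have := norm_sub_le (xF Δt) x
      linarith
    have h3 : L * ‖xF Δt - x‖ ≤ L * (d + (1 + L) * ‖x‖) := by gcongr
    have h4 : G * (d + ‖x‖) = d + L * (d + (1 + L) * ‖x‖) +
        (L * d + L ^ 2 * d + ‖x‖ + L * ‖x‖) := by simp only [G]; ring
    have h5 : 0 ≤ L * d + L ^ 2 * d + ‖x‖ + L * ‖x‖ := by positivity
    linarith
  refine ⟨hyΓ, lyapunov_contraction hm hM hJx hJM hG hθ hθG hηθ hd_def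
    (OptData.err_nonneg _ _ _) herr hdecr, fun τ hτ => ?_⟩
  have hbig := trajectory_sq_bound (L := L) hm hθ (hmJ' x hxa) hd hde
  have hdevτ := hdev τ hτ
  constructor
  · have h1 := pow_le_pow_left₀ (norm_nonneg _) hdevτ 2
    have h2 : 0 ≤ 2 * L ^ 2 * ‖x‖ ^ 2 := by positivity
    have h3 : 0 ≤ d ^ 2 := sq_nonneg d
    linarith
  · have h1 : ‖xF τ‖ ≤ L * ‖x‖ + d := by
      have := norm_add_le (S.x x τ) (xF τ - S.x x τ)
      rw [add_sub_cancel] at this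
      linarith [hxL x hxa hx₂ τ hτ]
    have h2 := pow_le_pow_left₀ (norm_nonneg _) h1 2
    have h3 := sq_nonneg (L * ‖x‖ - d)
    have h4 : (L * ‖x‖ + d) ^ 2 = 2 * L ^ 2 * ‖x‖ ^ 2 + 2 * d ^ 2 - (L * ‖x‖ - d) ^ 2 := by ring
    linarith

/-! ### Existence of runs -/

lemma OptData.ADMMBounded.exists_run (hbdd : S.ADMMBounded ρ a σz σμ) {x : P.State}
    (hx : x ∈ S.Γ a) {z₀ : P.ZTraj} {μ₀ : P.MTraj} (hz₀ : z₀ ∈ S.ZNhd a σz)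
    (hμ₀ : μ₀ ∈ S.MNhd a σμ) (q : ℕ) :
    ∃ w z μ, z 0 = z₀ ∧ μ 0 = μ₀ ∧ P.IsADMMRun ρ x q w z μ := by
  have hnext : ∀ s : {p : P.ZTraj × P.MTraj // p.1 ∈ S.ZNhd a σz ∧ p.2 ∈ S.MNhd a σμ},
      ∃ (w' : P.Primal) (s' : {p : P.ZTraj × P.MTraj // p.1 ∈ S.ZNhd a σz ∧ p.2 ∈ S.MNhd a σμ}),
        P.IsADMMStep ρ x s.1.1 s.1.2 w' s'.1.1 s'.1.2 := by
    rintro ⟨⟨z, μ⟩, hz, hμ⟩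
    obtain ⟨w', z', μ', h⟩ := hbdd.generates x hx z hz μ hμ
    -- A single step viewed as a run of length one, so that invariance of the neighbourhoods applies
    -- to it.
    have hrun : P.IsADMMRun ρ x 1 (fun _ => w') (fun n => if n = 0 then z else z')
        (fun n => if n = 0 then μ else μ') := fun k hk => by
      obtain rfl : k = 0 := by omega
      simpa only [if_true, zero_add, one_ne_zero, if_false] using h
    have hmem := hbdd.bounded x hx 1 _ _ _ hrun
    simp only [if_true, one_ne_zero, if_false] at hmem
    exact ⟨w', ⟨(z', μ'), hmem hz hμ⟩, h⟩
  choose W nxt hW using hnext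
  set st : ℕ → _ := fun n => nxt^[n] ⟨(z₀, μ₀), hz₀, hμ₀⟩
  -- The primal entry of index `k + 1` belongs to the step leaving iterate `k`; the entry at 0 is a
  -- filler.
  refine ⟨fun n => W (st (n - 1)), fun n => (st n).1.1, fun n => (st n).1.2, rfl, rfl,
    fun k _ => ?_⟩
  have : st (k + 1) = nxt (st k) := Function.iterate_succ_apply' _ _ _
  simp only [add_tsub_cancel_right, this]
  exact hW (st k)

/-- Dependent choice on triples of state, coordination variables and multipliers, confined to sets
that one MPC step leaves invariant. Positivity of `q` ensures that the applied control comes from an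
actual ADMM step. -/
lemma nonempty_closedLoop (hP : P.Standing) {q : ℕ} {α' : ℝ} (hα' : α' ≤ a)
    (hbdd : S.ADMMBounded ρ a σz σμ)
    (hinv : ∀ x ∈ S.Γ α', ∀ w z μ, P.IsADMMRun ρ x q w z μ → z 0 ∈ S.ZNhd a σz →
      μ 0 ∈ S.MNhd a σμ → ∀ xF, P.IsPlantTraj x (w q).u xF → xF Δt ∈ S.Γ α')
    (hq : 0 < q) {x₀ : P.State} (hx₀ : x₀ ∈ S.Γ α') {z₀ : P.ZTraj} {μ₀ : P.MTraj}
    (hz₀ : z₀ ∈ S.ZNhd a σz) (hμ₀ : μ₀ ∈ S.MNhd a σμ) :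
    Nonempty (P.ClosedLoop ρ Δt q x₀ z₀ μ₀) := by
  have hnext : ∀ s : {p : P.State × P.ZTraj × P.MTraj //
      p.1 ∈ S.Γ α' ∧ p.2.1 ∈ S.ZNhd a σz ∧ p.2.2 ∈ S.MNhd a σμ},
      ∃ (w : ℕ → P.Primal) (z : ℕ → P.ZTraj) (μ : ℕ → P.MTraj) (xF : ℝ → P.State),
        z 0 = s.1.2.1 ∧ μ 0 = s.1.2.2 ∧ P.IsADMMRun ρ s.1.1 q w z μ ∧
        P.IsPlantTraj s.1.1 (w q).u xF ∧
        (xF Δt ∈ S.Γ α' ∧ z q ∈ S.ZNhd a σz ∧ μ q ∈ S.MNhd a σμ) := by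
    rintro ⟨⟨x, z, μ⟩, hx, hz, hμ⟩
    have hxa : x ∈ S.Γ a := le_trans hx hα'
    obtain ⟨w, zs, μs, rfl, rfl, hrun⟩ := hbdd.exists_run hxa hz hμ q
    obtain ⟨k, rfl⟩ : ∃ k, q = k + 1 := ⟨q - 1, by omega⟩
    obtain ⟨xF, hxF⟩ := hP.response x _ (hrun k (by omega)).w_min.1.1
    exact ⟨w, zs, μs, xF, rfl, rfl, hrun, hxF, hinv x hx w zs μs hrun hz hμ xF hxF,
      hbdd.bounded x hxa _ w zs μs hrun hz hμ⟩
  choose w z μ xF h1 h2 h3 h4 h5 using hnext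
  set st : ℕ → _ := fun n =>
    (fun s => (⟨(xF s Δt, z s q, μ s q), h5 s⟩ : {p : P.State × P.ZTraj × P.MTraj //
      p.1 ∈ S.Γ α' ∧ p.2.1 ∈ S.ZNhd a σz ∧ p.2.2 ∈ S.MNhd a σμ}))^[n]
      ⟨(x₀, z₀, μ₀), hx₀, hz₀, hμ₀⟩
  have hst : ∀ n, st (n + 1) = ⟨(xF (st n) Δt, z (st n) q, μ (st n) q), h5 (st n)⟩ :=
    fun n => Function.iterate_succ_apply' _ _ _
  exact ⟨{
    x := fun k => (st k).1.1
    w := fun k => w (st k)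
    z := fun k => z (st k)
    mu := fun k => μ (st k)
    xF := fun k => xF (st k)
    x_zero := rfl
    z_zero := h1 _
    mu_zero := h2 _
    admm := fun k => h3 (st k)
    warm_z := fun k => by rw [h1 (st (k + 1)), hst k]
    warm_mu := fun k => by rw [h2 (st (k + 1)), hst k]
    plant := fun k => h4 (st k)
    next := fun k => by rw [hst k] }⟩

end DMPC

/-! ### Closed-loop decay from the one-step contraction -/

theorem mainTheorem2 {N : ℕ} (P : DMPC N) (hP : P.Standing)
    (β : ℝ) (hβ : P.IsCLF β)
    (ρ : ℝ) (hρ : 0 < ρ) (Δt : ℝ) (hΔt : 0 < Δt) (hΔtT : Δt ≤ P.T)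
    (S : P.OptData) (hopt : ∀ x₀, P.IsOptimal x₀ (S.x x₀) (S.u x₀))
    (hΓ : IsCompact (S.Γ (P.level β)))
    (hmult : S.HasMultipliers ρ (P.level β))
    (σz σμ : ℝ) (hσz : 0 < σz) (hσμ : 0 < σμ)
    (hreg : S.IsRegular ρ Δt (P.level β) σz σμ)
    (hbdd : S.ADMMBounded ρ (P.level β) σz σμ)
    (hconv : S.RLinear ρ (P.level β) σz σμ) :
    ∃ α' : ℝ, 0 < α' ∧ α' ≤ P.level β ∧ ∃ q : ℕ, 0 < q ∧
      ∃ c γ γ₁ γ₂ E : ℝ, 0 < c ∧ 0 < γ ∧ γ < 1 ∧ 0 < γ₁ ∧ 0 < γ₂ ∧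
        ∀ x₀ ∈ S.Γ α', ∀ z₀ ∈ S.ZNhd (P.level β) σz, ∀ μ₀ ∈ S.MNhd (P.level β) σμ,
          S.err x₀ z₀ μ₀ ≤ E ∧
          Nonempty (P.ClosedLoop ρ Δt q x₀ z₀ μ₀) ∧
          ∀ R : P.ClosedLoop ρ Δt q x₀ z₀ μ₀,
            (∀ k, R.x k ∈ S.Γ α') ∧
            (∀ k, S.J (R.x k) ≤ c * γ ^ k * (S.J x₀ + S.err x₀ z₀ μ₀ ^ 2)) ∧
            (∀ k, ∀ τ ∈ Set.Icc 0 P.T, ‖R.xF k τ - S.x (R.x k) τ‖ ≤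
              c * γ ^ k * (‖x₀‖ + S.err x₀ z₀ μ₀)) ∧
            (∀ t, 0 ≤ t → ‖R.state t‖ ≤
              γ₁ * (‖x₀‖ + S.err x₀ z₀ μ₀) * Real.exp (-γ₂ * t)) := by
  -- This includes `M_V = 0`, where division by zero makes the level equal to `β`.
  have hlevel : 0 < P.level β := by
    have h1 := hβ.1
    have h2 := hP.ml_pos
    have h3 := hP.MV_nonneg
    have h4 := hP.T_pos
    rw [DMPC.level]
    positivity
  obtain ⟨α', hα', hα'a, q, hq, θ, g, H, M, hθ, hg, hg1, hH, hM, hstep⟩ :=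
    DMPC.OptData.exists_contraction hP hβ hρ hΔt hΔtT hσz hσμ hlevel hopt hΓ hmult hreg hbdd hconv
  obtain ⟨E, -, hE⟩ := DMPC.OptData.exists_err_le hΓ hmult σz σμ
  -- The factor `g` governs squares, so norms decay with its square root; the bound on `J*` holds a
  -- fortiori with `γ`.
  set γ : ℝ := √g
  have hγ : 0 < γ := Real.sqrt_pos.2 hg
  have hγ1 : γ < 1 := by rw [Real.sqrt_lt' one_pos]; simpa using hg1
  have hγg : γ ^ 2 = g := Real.sq_sqrt hg.le
  have hgγ : g ≤ γ := by rw [← hγg]; nlinarith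
  set c₁ : ℝ := √(H * (M + θ))
  have hc₁ : 0 < c₁ := Real.sqrt_pos.2 (by positivity)
  set c : ℝ := max (1 + θ) c₁
  have hc : 0 < c := hc₁.trans_le (le_max_right _ _)
  have hlog : Real.log γ < 0 := Real.log_neg hγ hγ1
  -- The factor `1 / γ` pays for rounding: `k` exceeds `t / Δt - 1` only.
  refine ⟨α', hα', hα'a, q, hq, c, γ, c / γ, -Real.log γ / Δt, E, hc, hγ, hγ1, by positivity,
    div_pos (neg_pos.2 hlog) hΔt, fun x₀ hx₀ z₀ hz₀ μ₀ hμ₀ => ⟨hE x₀ (le_trans hx₀ hα'a) z₀ hz₀ μ₀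
      hμ₀, DMPC.nonempty_closedLoop hP hα'a hbdd (fun x hx w z μ hrun hz hμ xF hxF =>
      ((hstep x hx).2 w z μ hrun hz hμ xF hxF).1) hq hx₀ hz₀ hμ₀, fun R => ?_⟩⟩
  set e₀ := S.err x₀ z₀ μ₀
  have he₀ : 0 ≤ e₀ := DMPC.OptData.err_nonneg _ _ _
  have hJ₀ : 0 ≤ S.J x₀ := DMPC.OptData.J_nonneg hP _
  set W₀ : ℝ := S.J x₀ + θ * e₀ ^ 2
  have hinv : ∀ k, R.x k ∈ S.Γ α' ∧ R.z k 0 ∈ S.ZNhd (P.level β) σz ∧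
      R.mu k 0 ∈ S.MNhd (P.level β) σμ ∧
      S.J (R.x k) + θ * S.err (R.x k) (R.z k 0) (R.mu k 0) ^ 2 ≤ g ^ k * W₀ := by
    intro k
    induction k with
    | zero =>
      rw [R.x_zero, R.z_zero, R.mu_zero]
      exact ⟨hx₀, hz₀, hμ₀, by simp [W₀, e₀]⟩
    | succ k ih =>
      obtain ⟨h1, h2, h3, h4⟩ := ih
      obtain ⟨h5, h6, -⟩ := (hstep _ h1).2 _ _ _ (R.admm k) h2 h3 _ (R.plant k)
      have h7 := hbdd.bounded _ (le_trans h1 hα'a) q _ _ _ (R.admm k) h2 h3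
      rw [R.next, R.warm_z, R.warm_mu]
      exact ⟨h5, h7.1, h7.2, h6.trans (by
        rw [pow_succ' g k, mul_assoc]
        exact mul_le_mul_of_nonneg_left h4 hg.le)⟩
  -- The upper bound `J* ≤ M ‖x‖²` converts the initial Lyapunov value into `‖x₀‖ + e₀`.
  have hWbound : H * W₀ ≤ c₁ ^ 2 * (‖x₀‖ + e₀) ^ 2 := by
    rw [Real.sq_sqrt (by positivity), mul_assoc]
    gcongr
    have h1 := (hstep x₀ hx₀).1
    have h2 : 0 ≤ M * (2 * ‖x₀‖ * e₀ + e₀ ^ 2) + θ * (2 * ‖x₀‖ * e₀ + ‖x₀‖ ^ 2) := by positivity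
    have h3 : (M + θ) * (‖x₀‖ + e₀) ^ 2 = M * ‖x₀‖ ^ 2 + θ * e₀ ^ 2 +
      (M * (2 * ‖x₀‖ * e₀ + e₀ ^ 2) + θ * (2 * ‖x₀‖ * e₀ + ‖x₀‖ ^ 2)) := by ring
    linarith
  have hroot : ∀ (k : ℕ) (y : ℝ), y ^ 2 ≤ H * (g ^ k * W₀) → y ≤ c * γ ^ k * (‖x₀‖ + e₀) := by
    intro k y hy
    have h1 : y ^ 2 ≤ (c₁ * γ ^ k * (‖x₀‖ + e₀)) ^ 2 := by
      have h2 : (c₁ * γ ^ k * (‖x₀‖ + e₀)) ^ 2 = g ^ k * (c₁ ^ 2 * (‖x₀‖ + e₀) ^ 2) := by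
        rw [← hγg]; ring
      have h3 : g ^ k * (H * W₀) ≤ g ^ k * (c₁ ^ 2 * (‖x₀‖ + e₀) ^ 2) := by gcongr
      rw [h2]
      linarith
    refine (abs_le_of_sq_le_sq' h1 (by positivity)).2.trans ?_
    gcongr
    exact le_max_right _ _
  have hpred : ∀ k, ∀ τ ∈ Set.Icc 0 P.T,
      ‖R.xF k τ - S.x (R.x k) τ‖ ≤ c * γ ^ k * (‖x₀‖ + e₀) ∧
      ‖R.xF k τ‖ ≤ c * γ ^ k * (‖x₀‖ + e₀) := by
    intro k τ hτ
    obtain ⟨h1, h2, h3, h4⟩ := hinv k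
    obtain ⟨h5, h6⟩ := ((hstep _ h1).2 _ _ _ (R.admm k) h2 h3 _ (R.plant k)).2.2 τ hτ
    exact ⟨hroot k _ (h5.trans (by gcongr)), hroot k _ (h6.trans (by gcongr))⟩
  refine ⟨fun k => (hinv k).1, fun k => ?_, fun k τ hτ => (hpred k τ hτ).1, fun t ht => ?_⟩
  · have h1 : W₀ ≤ (1 + θ) * (S.J x₀ + e₀ ^ 2) := by
      have : 0 ≤ θ * S.J x₀ + e₀ ^ 2 := by positivity
      simp only [W₀]; linarith
    have h2 : 0 ≤ θ * S.err (R.x k) (R.z k 0) (R.mu k 0) ^ 2 := by positivity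
    calc S.J (R.x k) ≤ g ^ k * W₀ := by linarith [(hinv k).2.2.2]
      _ ≤ γ ^ k * (c * (S.J x₀ + e₀ ^ 2)) := by
        gcongr
        exact h1.trans (by gcongr; exact le_max_left _ _)
      _ = c * γ ^ k * (S.J x₀ + e₀ ^ 2) := by ring
  · set k := ⌊t / Δt⌋₊
    have hk1 : (k : ℝ) * Δt ≤ t := by
      rw [← le_div_iff₀ hΔt]; exact Nat.floor_le (by positivity)
    have hk2 : t < (k + 1) * Δt := by
      rw [← div_lt_iff₀ hΔt]; exact Nat.lt_floor_add_one _
    have hτ : t - k * Δt ∈ Set.Icc 0 P.T := ⟨by linarith, by linarith⟩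
    refine ((hpred k _ hτ).2).trans ?_
    have hexp : γ ^ k ≤ γ⁻¹ * Real.exp (-(-Real.log γ / Δt) * t) := by
      rw [← Real.exp_log (pow_pos hγ k), Real.log_pow, ← Real.exp_log (inv_pos.2 hγ), Real.log_inv,
        ← Real.exp_add]
      refine Real.exp_le_exp.2 ?_
      have h1 : t / Δt ≤ k + 1 := by rw [div_le_iff₀ hΔt]; exact hk2.le
      have h2 : -(-Real.log γ / Δt) * t = Real.log γ * (t / Δt) := by field_simp
      rw [h2]
      nlinarith
    calc c * γ ^ k * (‖x₀‖ + e₀)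
        ≤ c * (γ⁻¹ * Real.exp (-(-Real.log γ / Δt) * t)) * (‖x₀‖ + e₀) := by gcongr
      _ = c / γ * (‖x₀‖ + e₀) * Real.exp (-(-Real.log γ / Δt) * t) := by
        rw [div_eq_mul_inv]; ring
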